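/- Let $\lambda,\mu,\theta,\delta_{RD},\delta_{RC}\ge 0$, $s\in\{0,1,2,\dots\}$ and $p,q\in[0,1]$. For each $n=1,2,\dots$ consider a call center with fresh arrival rate $\lambda n$ and $ns$ servers, whose state $Z^{(n)}(t)=(Z^{(n)}_Q(t),Z^{(n)}_{RD}(t),Z^{(n)}_{RC}(t))\in\mathbb{Z}_+^3$, $t\ge 0$ (number of customers in queue plus in service, in the redial orbit, and in the reconnect orbit), is a stochastic process with càdlàg paths that satisfies almost surely, for all $t\ge 0$, \begin{align*} Z^{(n)}_Q(t)&=Z^{(n)}_Q(0)+\Pi^{(n)}_{\lambda n}(t)+D^{(n)}_{RD}(t)+D^{(n)}_{RC}(t)-D^{(n)}_s(t)-D^{(n)}_a(t),\\ Z^{(n)}_{RD}(t)&=Z^{(n)}_{RD}(0)+\sum_{j=1}^{D^{(n)}_a(t)}B^{(n)}_j(p)-D^{(n)}_{RD}(t),\\ Z^{(n)}_{RC}(t)&=Z^{(n)}_{RC}(0)+\sum_{j=1}^{D^{(n)}_s(t)}B^{(n)}_j(q)-D^{(n)}_{RC}(t), \end{align*} where \begin{align*} D^{(n)}_s(t)&=\Pi^{(n)}_1\Bigl(\int_0^t\mu\min\{ns,Z^{(n)}_Q(u)\}\,du\Bigr),&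 D^{(n)}_a(t)&=\Pi^{(n)}_2\Bigl(\int_0^t\theta\,(Z^{(n)}_Q(u)-ns)^+\,du\Bigr),\\ D^{(n)}_{RD}(t)&=\Pi^{(n)}_3\Bigl(\int_0^t\delta_{RD}Z^{(n)}_{RD}(u)\,du\Bigr),& D^{(n)}_{RC}(t)&=\Pi^{(n)}_4\Bigl(\int_0^t\delta_{RC}Z^{(n)}_{RC}(u)\,du\Bigr). \end{align*} Here $\Pi^{(n)}_{\lambda n}$ is a Poisson process of rate $\lambda n$, $\Pi^{(n)}_1,\dots,\Pi^{(n)}_4$ are Poisson processes of rate $1$, $B^{(n)}_j(p)$ and $B^{(n)}_j(q)$, $j\ge 1$, are Bernoulli variables with success probabilities $p$ and $q$, and for each $n$ these processes and variables and the initial state $Z^{(n)}(0)$ are mutually independent. The systems for different $n$ may live on different probability spaces. Let $\bar Z^{(n)}(t)=Z^{(n)}(t)/n$. Let $(z_Q(0),z_{RD}(0),z_{RC}(0))\in\mathbb{R}^3$ be deterministic, and assume that $\bar Z^{(n)}(0)$ converges in distribution to $(z_Q(0),z_{RD}(0),z_{RC}(0))$ as $n\to\infty$. Then the system of equations (for all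 $t\ge 0$) \begin{align*} z_Q(t)&=z_Q(0)+\lambda t+\delta_{RD}\int_0^t z_{RD}(u)\,du+\delta_{RC}\int_0^t z_{RC}(u)\,du\\ &\quad-\mu\int_0^t\min\{s,z_Q(u)\}\,du-\theta\int_0^t(z_Q(u)-s)^+\,du,\\ z_{RD}(t)&=z_{RD}(0)+p\theta\int_0^t(z_Q(u)-s)^+\,du-\delta_{RD}\int_0^t z_{RD}(u)\,du,\\ z_{RC}(t)&=z_{RC}(0)+q\mu\int_0^t\min\{s,z_Q(u)\}\,du-\delta_{RC}\int_0^t z_{RC}(u)\,du \end{align*} has exactly one locally integrable solution $z=(z_Q,z_{RD},z_{RC}):[0,\infty)\to\mathbb{R}^3$; this solution is continuous, and $\bar Z^{(n)}$ converges weakly to $z$ as $n\to\infty$, in $D([0,\infty),\mathbb{R}^3)$ with the Skorokhod $J_1$ topology. -/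

import Mathlib

open MeasureTheory ProbabilityTheory Filter Topology Set
open scoped NNReal

/-! ### The Skorokhod space `D([0, ∞), E)` -/

/-- Càdlàg functions `[0, ∞) → E`: right continuous, with left limits. -/
structure SkorokhodSpace (E : Type*) [TopologicalSpace E] where
  toFun : ℝ≥0 → E
  right_continuous : ∀ t, ContinuousWithinAt toFun (Ici t) t
  left_limits : ∀ t, ∃ l, Tendsto toFun (𝓝[<] t) (𝓝 l)

namespace SkorokhodSpace

instance {E : Type*} [TopologicalSpace E] : CoeFun (SkorokhodSpace E) (fun _ => ℝ≥0 → E) :=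
  ⟨SkorokhodSpace.toFun⟩

/-- Composition of a càdlàg path with a continuous map of the state spaces. -/
def map {E F : Type*} [TopologicalSpace E] [TopologicalSpace F] (f : E → F) (hf : Continuous f)
    (x : SkorokhodSpace E) : SkorokhodSpace F where
  toFun t := f (x t)
  right_continuous t := hf.continuousAt.comp_continuousWithinAt (x.right_continuous t)
  left_limits t := by
    obtain ⟨l, hl⟩ := x.left_limits t
    exact ⟨f l, (hf.tendsto l).comp hl⟩

/-- Two paths `x, y` are `(T, ε)`-close if some increasing bijection `γ` of `[0, ∞)` (a time change)
satisfies `|γ t - t| < ε` and `dist (x t) (y (γ t)) < ε` for all `t ≤ T`. -/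
def close (E : Type*) [PseudoMetricSpace E] (T : ℝ≥0) (ε : ℝ) :
    Set (SkorokhodSpace E × SkorokhodSpace E) :=
  {x | ∃ γ : ℝ≥0 ≃o ℝ≥0, ∀ t ≤ T, dist (γ t) t < ε ∧ dist (x.1 t) (x.2 (γ t)) < ε}

theorem close_mono {E : Type*} [PseudoMetricSpace E] {T T' : ℝ≥0} {ε ε' : ℝ} (hT : T ≤ T')
    (hε : ε' ≤ ε) : close E T' ε' ⊆ close E T ε := by
  rintro x ⟨γ, h⟩
  exact ⟨γ, fun t ht => ⟨(h t (ht.trans hT)).1.trans_le hε, (h t (ht.trans hT)).2.trans_le hε⟩⟩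

theorem close_symm {E : Type*} [PseudoMetricSpace E] (T : ℝ≥0) (ε : ℝ) (hε : 0 < ε) :
    close E (T + ⟨ε, hε.le⟩) ε ⊆ Prod.swap ⁻¹' close E T ε := by
  rintro ⟨x, y⟩ ⟨γ, h⟩
  refine ⟨γ.symm, fun s hs => ?_⟩
  have hle : γ.symm s ≤ T + ⟨ε, hε.le⟩ := by
    by_contra hlt
    have h1 : γ (T + ⟨ε, hε.le⟩) < s := by
      have := γ.strictMono (not_le.1 hlt)
      simpa using this
    have h2 := (h _ le_rfl).1
    rw [NNReal.dist_eq, abs_lt] at h2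
    have h3 : ((γ (T + ⟨ε, hε.le⟩) : ℝ≥0) : ℝ) < s := by exact_mod_cast h1
    have h4 : (s : ℝ) ≤ T := by exact_mod_cast hs
    have h5 := h2.1
    change -ε < _ - ((T : ℝ) + ε) at h5
    linarith
  have h1 := h _ hle
  simp only [OrderIso.apply_symm_apply] at h1
  exact ⟨by rw [dist_comm]; exact h1.1, by rw [dist_comm]; exact h1.2⟩

/-- The Skorokhod `J₁` topology on `D([0, ∞), E)`, given by a uniform structure with the sets
`close E T ε` (`T ≥ 0`, `ε > 0`) as a basis of entourages. Thus `xₙ → x` iff for each `T` there are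
increasing bijections `γₙ` of `[0, ∞)` such that `|γₙ t - t|` and `dist (x t) (xₙ (γₙ t))` tend to
`0`, uniformly in `t ≤ T`. -/
instance {E : Type*} [PseudoMetricSpace E] : UniformSpace (SkorokhodSpace E) :=
  UniformSpace.ofCore <| UniformSpace.Core.mkOfBasis
    { sets := {S | ∃ T : ℝ≥0, ∃ ε : ℝ, 0 < ε ∧ S = close E T ε}
      nonempty := ⟨_, 0, 1, one_pos, rfl⟩
      inter_sets := by
        rintro _ _ ⟨T, ε, hε, rfl⟩ ⟨T', ε', hε', rfl⟩
        exact ⟨_, ⟨max T T', min ε ε', lt_min hε hε', rfl⟩, subset_inter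
          (close_mono (le_max_left _ _) (min_le_left _ _))
          (close_mono (le_max_right _ _) (min_le_right _ _))⟩ }
    (by
      rintro _ ⟨T, ε, hε, rfl⟩ x
      exact ⟨OrderIso.refl _, fun t _ => by simpa using hε⟩)
    (by
      rintro _ ⟨T, ε, hε, rfl⟩
      exact ⟨_, ⟨T + ⟨ε, hε.le⟩, ε, hε, rfl⟩, close_symm T ε hε⟩)
    (by
      rintro _ ⟨T, ε, hε, rfl⟩
      refine ⟨_, ⟨T + ⟨ε / 2, by positivity⟩, ε / 2, by positivity, rfl⟩, ?_⟩
      rintro ⟨x, z⟩ ⟨y, ⟨γ, h⟩, ⟨γ', h'⟩⟩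
      refine ⟨γ.trans γ', fun t ht => ?_⟩
      have h1 := h t (ht.trans le_self_add)
      have hγ : γ t ≤ T + ⟨ε / 2, by positivity⟩ := by
        have h2 := h1.1
        rw [NNReal.dist_eq, abs_lt] at h2
        rw [← NNReal.coe_le_coe]
        change (γ t : ℝ) ≤ (T : ℝ) + ε / 2
        have h3 : (t : ℝ) ≤ T := by exact_mod_cast ht
        linarith [h2.2]
      have h2 := h' _ hγ
      simp only [OrderIso.trans_apply]
      constructor
      · calc dist (γ' (γ t)) t ≤ dist (γ' (γ t)) (γ t) + dist (γ t) t := dist_triangle _ _ _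
          _ < ε := by linarith [h1.1, h2.1]
      · calc dist (x t) (z (γ' (γ t)))
            ≤ dist (x t) (y (γ t)) + dist (y (γ t)) (z (γ' (γ t))) := dist_triangle _ _ _
          _ < ε := by linarith [h1.2, h2.2])

/-- The Skorokhod space carries the Borel σ-algebra of the `J₁` topology. -/
instance {E : Type*} [PseudoMetricSpace E] : MeasurableSpace (SkorokhodSpace E) := borel _

instance {E : Type*} [PseudoMetricSpace E] : BorelSpace (SkorokhodSpace E) := ⟨rfl⟩

end SkorokhodSpace

/-! ### The call center with redials and reconnects -/

/-- `N` is a Poisson process of rate `r`: almost all of its paths start at `0`, are nondecreasing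
and right continuous, and its increments are independent and Poisson distributed. -/
structure IsPoissonProcess {Ω : Type*} [MeasurableSpace Ω] (r : ℝ≥0) (N : ℝ≥0 → Ω → ℕ)
    (P : Measure Ω) : Prop where
  measurable : ∀ t, Measurable (N t)
  path : ∀ᵐ ω ∂P, N 0 ω = 0 ∧ Monotone (fun t => N t ω) ∧
    ∀ t, ContinuousWithinAt (fun u => N u ω) (Ici t) t
  indep_increments : HasIndepIncrements N P
  law_increments : ∀ u t, u ≤ t → HasLaw (fun ω => N t ω - N u ω) (poissonMeasure (r * (t - u))) P

/-- The parameters of the model. -/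
structure CallCenterParams where
  /-- fresh arrival rate `λ` -/
  lam : ℝ≥0
  /-- service rate `μ` of an agent -/
  mu : ℝ≥0
  /-- abandonment rate `θ` of a waiting customer -/
  theta : ℝ≥0
  /-- redial rate `δ_RD` of a customer in the redial orbit -/
  deltaRD : ℝ≥0
  /-- reconnect rate `δ_RC` of a customer in the reconnect orbit -/
  deltaRC : ℝ≥0
  /-- number `s` of agents -/
  s : ℕ
  /-- probability `p` that an abandoned customer enters the redial orbit -/
  p : unitInterval
  /-- probability `q` that a served customer enters the reconnect orbit -/
  q : unitInterval

/-- `∫₀ᵗ f(u) du` for a function `f` on `[0, ∞)`. -/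
noncomputable def timeIntegral (f : ℝ≥0 → ℝ) (t : ℝ≥0) : ℝ :=
  ∫ u in (0 : ℝ)..t, f u.toNNReal

/-- The five sources of events in the system. -/
inductive Clock
  | fresh
  | service
  | abandonment
  | redial
  | reconnect

/-- The sources of randomness in the system: the initial state, the five Poisson processes, and the
decisions of the `j`-th abandoned and of the `j`-th served customer to call again. -/
inductive Source
  | initial
  | clock (c : Clock)
  | redialDecision (j : ℕ)
  | reconnectDecision (j : ℕ)

/-- The `n`-th model: fresh arrival rate `λ n` and `n s` servers, on a probability space `(Ω, P)`.
The coordinates `0, 1, 2` of the state are `Z_Q` (queue plus in service), `Z_RD` (redial orbit)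
and `Z_RC` (reconnect orbit). -/
structure CallCenterModel (prm : CallCenterParams) (n : ℕ+) {Ω : Type*} [MeasurableSpace Ω]
    (P : Measure Ω) where
  /-- the state process -/
  Z : Ω → SkorokhodSpace (Fin 3 → ℕ)
  /-- the Poisson processes: `Π_{λn}` for fresh arrivals, and `Π₁, …, Π₄` of rate `1` -/
  clock : Clock → ℝ≥0 → Ω → ℕ
  /-- `B_j(p)`, indexed from `j = 0` -/
  redialDecision : ℕ → Ω → ℕ
  /-- `B_j(q)`, indexed from `j = 0` -/
  reconnectDecision : ℕ → Ω → ℕ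
  /-- the number `D_s(t)` of served customers up to time `t` -/
  Ds : ℝ≥0 → Ω → ℕ
  /-- the number `D_a(t)` of abandoned customers up to time `t` -/
  Da : ℝ≥0 → Ω → ℕ
  /-- the number `D_RD(t)` of redials up to time `t` -/
  DRD : ℝ≥0 → Ω → ℕ
  /-- the number `D_RC(t)` of reconnects up to time `t` -/
  DRC : ℝ≥0 → Ω → ℕ
  measurable_Z : ∀ t, Measurable (fun ω => Z ω t)
  measurable_redialDecision : ∀ j, Measurable (redialDecision j)
  measurable_reconnectDecision : ∀ j, Measurable (reconnectDecision j)
  poisson_fresh : IsPoissonProcess (prm.lam * n) (clock .fresh) P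
  poisson_unit : ∀ c, c ≠ .fresh → IsPoissonProcess 1 (clock c) P
  law_redialDecision : ∀ j, HasLaw (redialDecision j) (bernoulliMeasure 1 0 prm.p) P
  law_reconnectDecision : ∀ j, HasLaw (reconnectDecision j) (bernoulliMeasure 1 0 prm.q) P
  /-- all sources of randomness are mutually independent -/
  indep : iIndep (fun i : Source => match i with
    | .initial => MeasurableSpace.comap (fun ω => Z ω 0) inferInstance
    | .clock c => ⨆ t, MeasurableSpace.comap (clock c t) inferInstance
    | .redialDecision j => MeasurableSpace.comap (redialDecision j) inferInstance
    | .reconnectDecision j => MeasurableSpace.comap (reconnectDecision j) inferInstance) P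
  Ds_eq : ∀ t ω, Ds t ω = clock .service
    (timeIntegral (fun u => prm.mu * min ((n : ℝ) * prm.s) (Z ω u 0)) t).toNNReal ω
  Da_eq : ∀ t ω, Da t ω = clock .abandonment
    (timeIntegral (fun u => prm.theta * max ((Z ω u 0 : ℝ) - n * prm.s) 0) t).toNNReal ω
  DRD_eq : ∀ t ω, DRD t ω = clock .redial
    (timeIntegral (fun u => prm.deltaRD * (Z ω u 1 : ℝ)) t).toNNReal ω
  DRC_eq : ∀ t ω, DRC t ω = clock .reconnect
    (timeIntegral (fun u => prm.deltaRC * (Z ω u 2 : ℝ)) t).toNNReal ω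
  flow_Q : ∀ᵐ ω ∂P, ∀ t, (Z ω t 0 : ℤ) =
    Z ω 0 0 + clock .fresh t ω + DRD t ω + DRC t ω - Ds t ω - Da t ω
  flow_RD : ∀ᵐ ω ∂P, ∀ t, (Z ω t 1 : ℤ) =
    Z ω 0 1 + (∑ j ∈ Finset.range (Da t ω), redialDecision j ω : ℕ) - DRD t ω
  flow_RC : ∀ᵐ ω ∂P, ∀ t, (Z ω t 2 : ℤ) =
    Z ω 0 2 + (∑ j ∈ Finset.range (Ds t ω), reconnectDecision j ω : ℕ) - DRC t ω

/-- The fluid-scaled process `Z̄⁽ⁿ⁾ = Z⁽ⁿ⁾ / n`, as a random element of `D([0, ∞), ℝ³)`. -/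
noncomputable def CallCenterModel.scaled {prm : CallCenterParams} {n : ℕ+} {Ω : Type*}
    [MeasurableSpace Ω] {P : Measure Ω} (M : CallCenterModel prm n P) (ω : Ω) :
    SkorokhodSpace (Fin 3 → ℝ) :=
  (M.Z ω).map (fun x i => (x i : ℝ) / n) continuous_of_discreteTopology

/-- `z : [0, ∞) → ℝ³` (with coordinates `z_Q, z_RD, z_RC`) is locally integrable and solves the
fluid equations with initial value `z₀`. -/
structure IsFluidSolution (prm : CallCenterParams) (z₀ : Fin 3 → ℝ) (z : ℝ≥0 → Fin 3 → ℝ) :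
    Prop where
  integrable : ∀ (i : Fin 3) (t : ℝ≥0),
    IntervalIntegrable (fun u : ℝ => z u.toNNReal i) volume 0 t
  eq_Q : ∀ t, z t 0 = z₀ 0 + prm.lam * t
    + prm.deltaRD * timeIntegral (fun u => z u 1) t
    + prm.deltaRC * timeIntegral (fun u => z u 2) t
    - prm.mu * timeIntegral (fun u => min (prm.s : ℝ) (z u 0)) t
    - prm.theta * timeIntegral (fun u => max (z u 0 - prm.s) 0) t
  eq_RD : ∀ t, z t 1 = z₀ 1
    + prm.p * prm.theta * timeIntegral (fun u => max (z u 0 - prm.s) 0) t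
    - prm.deltaRD * timeIntegral (fun u => z u 1) t
  eq_RC : ∀ t, z t 2 = z₀ 2
    + prm.q * prm.mu * timeIntegral (fun u => min (prm.s : ℝ) (z u 0)) t
    - prm.deltaRC * timeIntegral (fun u => z u 2) t

/-! The fluid system is an integral equation `z = z₀ + ∫ drift z` with a globally Lipschitz vector
field, so existence follows from a contraction argument and uniqueness from Grönwall's inequality.
The scaled call center solves the same equation path by path, up to noise: each counting process is
a Poisson process run at its cumulative intensity, and each orbit is fed by a Bernoulli thinning of
departures.

The noise is small by laws of large numbers that hold uniformly over deterministic windows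
(`withHighProbability_poissonProcess`, `withHighProbability_unitPoissonProcess`,
`withHighProbability_bernoulli`). Uniformity makes the dependence between a clock and the random
time at which it is read harmless, provided that this time stays in the window. It does, because
redials and reconnects only move customers inside the system: the population never exceeds the
initial one plus the fresh arrivals (`GoodPath.sum_le`), which bounds all intensities. On the
resulting good event the path solves the fluid equations with error `6 ε`
(`GoodPath.abs_scaled_sub_le`), and Grönwall (`dist_le_of_approx_fluid`) makes it uniformly close to
`z` on `[0, T]`. Uniform closeness is `J₁` closeness with the identity time change, and
concentration at a deterministic path gives weak convergence by the portmanteau theorem.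

The scaled path must also be Borel for the `J₁` topology. It is a `J₁` limit of step paths, which
depend continuously on sampled values (`measurable_of_eval`). -/

/-! ### The `J₁` topology and measurability of random càdlàg paths -/

namespace SkorokhodSpace

theorem hasBasis_uniformity (E : Type*) [PseudoMetricSpace E] :
    (uniformity (SkorokhodSpace E)).HasBasis (fun p : ℝ≥0 × ℝ => 0 < p.2)
      (fun p => close E p.1 p.2) := by
  constructor
  intro S
  change S ∈ FilterBasis.filter _ ↔ _
  rw [FilterBasis.mem_filter_iff]
  constructor
  · rintro ⟨_, ⟨T, ε, hε, rfl⟩, h⟩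
    exact ⟨(T, ε), hε, h⟩
  · rintro ⟨⟨T, ε⟩, hε, h⟩
    exact ⟨_, ⟨T, ε, hε, rfl⟩, h⟩

/-- Makes the Skorokhod space pseudometrizable, so that pointwise limits of measurable maps into it
are measurable. -/
instance {E : Type*} [PseudoMetricSpace E] :
    (uniformity (SkorokhodSpace E)).IsCountablyGenerated := by
  have h : (uniformity (SkorokhodSpace E)).HasBasis (fun _ : ℕ => True)
      (fun n => close E n (1 / ((n : ℝ) + 1))) := by
    refine (hasBasis_uniformity E).to_hasBasis ?_ ?_
    · rintro ⟨T, ε⟩ hε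
      obtain ⟨n, hn⟩ := exists_nat_one_div_lt hε
      obtain ⟨k, hk⟩ := exists_nat_ge T
      refine ⟨max n k, trivial, close_mono (hk.trans ?_) (le_trans ?_ hn.le)⟩
      · exact_mod_cast le_max_right _ _
      · apply one_div_le_one_div_of_le (by positivity)
        have : (n : ℝ) ≤ (max n k : ℕ) := by exact_mod_cast le_max_left _ _
        linarith
    · intro n _
      exact ⟨(n, 1 / ((n : ℝ) + 1)), by positivity, subset_rfl⟩
  exact h.isCountablyGenerated

theorem hasBasis_nhds {E : Type*} [PseudoMetricSpace E] (x : SkorokhodSpace E) :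
    (𝓝 x).HasBasis (fun p : ℝ≥0 × ℝ => 0 < p.2) (fun p => {y | (x, y) ∈ close E p.1 p.2}) :=
  nhds_basis_uniformity' (hasBasis_uniformity E)

/-- The path which is constant, equal to `y k`, on `[k / (m + 1), (k + 1) / (m + 1))`. -/
noncomputable def step {E : Type*} [TopologicalSpace E] (m : ℕ) (y : ℕ → E) :
    SkorokhodSpace E where
  toFun t := y ⌊((m : ℝ≥0) + 1) * t⌋₊
  right_continuous t := by
    refine tendsto_const_nhds.congr' ?_
    have h : ∀ᶠ u in 𝓝[≥] t, ((m : ℝ≥0) + 1) * u < ⌊((m : ℝ≥0) + 1) * t⌋₊ + 1 := by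
      apply nhdsWithin_le_nhds
      exact (continuous_const.mul continuous_id).continuousAt.eventually_lt continuousAt_const
        (Nat.lt_floor_add_one _)
    filter_upwards [h, self_mem_nhdsWithin] with u hu htu
    congr 1
    symm
    rw [Nat.floor_eq_iff (by positivity)]
    exact ⟨(Nat.floor_le (by positivity)).trans (by gcongr; exact htu), hu⟩
  left_limits t := by
    -- Just before `t > 0` the floor is `⌈(m + 1) t⌉₊ - 1`, also when `t` is a grid point. At `t =
    -- 0` the left filter is `⊥` and the truncated subtraction is harmless.
    refine ⟨y (⌈((m : ℝ≥0) + 1) * t⌉₊ - 1), tendsto_const_nhds.congr' ?_⟩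
    rcases eq_or_ne t 0 with rfl | ht
    · rw [show 𝓝[<] (0 : ℝ≥0) = ⊥ by simp]; exact eventually_bot
    have hpos : 0 < ⌈((m : ℝ≥0) + 1) * t⌉₊ := Nat.ceil_pos.2 (by positivity)
    have hlt : ((⌈((m : ℝ≥0) + 1) * t⌉₊ - 1 : ℕ) : ℝ≥0) < ((m : ℝ≥0) + 1) * t := by
      rw [← Nat.lt_ceil]; omega
    have h : ∀ᶠ u in 𝓝[<] t, ((⌈((m : ℝ≥0) + 1) * t⌉₊ - 1 : ℕ) : ℝ≥0) < ((m : ℝ≥0) + 1) * u := by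
      apply nhdsWithin_le_nhds
      exact continuousAt_const.eventually_lt (continuous_const.mul continuous_id).continuousAt hlt
    filter_upwards [h, self_mem_nhdsWithin] with u hu htu
    congr 1
    symm
    rw [Nat.floor_eq_iff (by positivity)]
    refine ⟨hu.le, ?_⟩
    have h1 : ((m : ℝ≥0) + 1) * u < ((m : ℝ≥0) + 1) * t := by gcongr; exact htu
    have h2 := h1.trans_le (Nat.le_ceil _)
    have h3 : ((⌈((m : ℝ≥0) + 1) * t⌉₊ - 1 : ℕ) : ℝ≥0) + 1 = ⌈((m : ℝ≥0) + 1) * t⌉₊ := by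
      exact_mod_cast Nat.sub_add_cancel hpos
    rwa [h3]

/-- On `[0, T]` a step path involves only finitely many coordinates of `y`, and no time change is
needed. -/
theorem continuous_step {E : Type*} [PseudoMetricSpace E] (m : ℕ) :
    Continuous (step (E := E) m) := by
  rw [continuous_iff_continuousAt]
  intro y
  rw [ContinuousAt, (hasBasis_nhds _).tendsto_right_iff]
  rintro ⟨T, ε⟩ hε
  have h : ∀ᶠ y' in 𝓝 y, ∀ k ∈ Finset.range (⌊((m : ℝ≥0) + 1) * T⌋₊ + 1),
      dist (y k) (y' k) < ε := by
    rw [eventually_all_finset]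
    intro k _
    have : Tendsto (fun y' : ℕ → E => dist (y k) (y' k)) (𝓝 y) (𝓝 (dist (y k) (y k))) :=
      (continuous_const.dist (continuous_apply k)).tendsto y
    rw [dist_self] at this
    exact this.eventually_lt_const hε
  filter_upwards [h] with y' hy'
  refine ⟨OrderIso.refl _, fun t ht => ⟨by simpa using hε, hy' _ ?_⟩⟩
  rw [Finset.mem_range, Nat.lt_succ_iff]
  exact Nat.floor_le_floor (by gcongr)

/-- On `[0, T]`, the oscillation of a càdlàg path between consecutive points of a suitable finite
set is small. -/
theorem exists_finset_dist_lt {E : Type*} [PseudoMetricSpace E] (x : SkorokhodSpace E) (T : ℝ≥0)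
    {ε : ℝ} (hε : 0 < ε) :
    ∃ F : Finset ℝ≥0, ∀ t ≤ T, ∀ u, (∀ f ∈ F, f ≤ t ↔ f ≤ u) → dist (x t) (x u) < ε := by
  have key : ∃ F : Finset ℝ≥0, ∀ t ∈ Icc 0 T, ∀ u, (∀ f ∈ F, f ≤ t ↔ f ≤ u) →
      dist (x t) (x u) < ε := by
    -- The condition on `F` says that `t` and `u` lie in the same cell of the partition cut by `F`.
    -- By compactness, finitely many cuts near each point suffice.
    refine isCompact_Icc.induction_on (p := fun S => ∃ F : Finset ℝ≥0, ∀ t ∈ S, ∀ u,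
      (∀ f ∈ F, f ≤ t ↔ f ≤ u) → dist (x t) (x u) < ε) ⟨∅, by simp⟩ ?_ ?_ ?_
    · rintro S S' h ⟨F, hF⟩
      exact ⟨F, fun t ht => hF t (h ht)⟩
    · classical
      rintro S S' ⟨F, hF⟩ ⟨F', hF'⟩
      refine ⟨F ∪ F', ?_⟩
      rintro t (ht | ht) u h
      · exact hF t ht u fun f hf => h f (Finset.mem_union_left _ hf)
      · exact hF' t ht u fun f hf => h f (Finset.mem_union_right _ hf)
    · intro v _
      classical
      obtain ⟨l, hl⟩ := x.left_limits v
      have hr := x.right_continuous v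
      have h1 : ∀ᶠ t in 𝓝[≥] v, dist (x t) (x v) < ε / 2 :=
        Metric.tendsto_nhds.1 hr _ (half_pos hε)
      have h2 : ∀ᶠ t in 𝓝[<] v, dist (x t) l < ε / 2 :=
        Metric.tendsto_nhds.1 hl _ (half_pos hε)
      obtain ⟨b, hvb, hb⟩ := (mem_nhdsGE_iff_exists_Ico_subset).1 h1
      have left : ∃ a : Finset ℝ≥0, (∀ᶠ t in 𝓝 v, ∀ c ∈ a, c ≤ t) ∧
          ∀ t < v, (∀ c ∈ a, c ≤ t) → dist (x t) l < ε / 2 := by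
        rcases eq_or_ne v 0 with rfl | hv
        · exact ⟨∅, by simp, fun t ht => absurd ht (not_lt.2 zero_le)⟩
        · obtain ⟨a', hav', ha'⟩ := (mem_nhdsLT_iff_exists_Ioo_subset' (pos_iff_ne_zero.2 hv)).1 h2
          obtain ⟨a, haa, hav⟩ := exists_between (mem_Iio.1 hav')
          refine ⟨{a}, ?_, fun t ht h => ha' ⟨haa.trans_le (h a (by simp)), ht⟩⟩
          filter_upwards [lt_mem_nhds hav] with t ht
          simpa using ht.le
      obtain ⟨a, ha, hal⟩ := left
      -- Left of the cut `v` the path is near its left limit, right of it near `x v`; the cuts in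
      -- `a` and `b` keep `u` in the region where this holds.
      refine ⟨{t | (∀ c ∈ a, c ≤ t) ∧ t < b}, nhdsWithin_le_nhds ?_, insert v (insert b a), ?_⟩
      · filter_upwards [ha, gt_mem_nhds hvb] with t h h' using ⟨h, h'⟩
      · rintro t ⟨hta, htb⟩ u h
        have hub : u < b := by
          rw [← not_le, ← h b (by simp), not_le]; exact htb
        rcases lt_or_ge t v with htv | htv
        · have huv : u < v := by
            rw [← not_le, ← h v (by simp), not_le]; exact htv
          have e1 := hal t htv hta
          have e2 := hal u huv fun c hc => (h c (by simp [hc])).1 (hta c hc)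
          calc dist (x t) (x u) ≤ dist (x t) l + dist (x u) l := dist_triangle_right _ _ _
            _ < ε := by linarith
        · have huv : v ≤ u := (h v (by simp)).1 htv
          have e1 : dist (x t) (x v) < ε / 2 := hb ⟨htv, htb⟩
          have e2 : dist (x u) (x v) < ε / 2 := hb ⟨huv, hub⟩
          calc dist (x t) (x u) ≤ dist (x t) (x v) + dist (x u) (x v) := dist_triangle_right _ _ _
            _ < ε := by linarith
  obtain ⟨F, hF⟩ := key
  exact ⟨F, fun t ht => hF t ⟨zero_le, ht⟩⟩

end SkorokhodSpace

/-- Small displacements of finitely many points extend to a time change close to the identity. -/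
theorem exists_orderIso_eq_of_dist_le (F : Finset ℝ≥0) (T : ℝ≥0) {ε : ℝ} (hε : 0 < ε) :
    ∃ η > 0, ∀ d : ℝ≥0 → ℝ, d 0 = 0 → (∀ f ∈ F, |d f| ≤ η) →
      ∃ γ : ℝ≥0 ≃o ℝ≥0, (∀ f ∈ F, (γ f : ℝ) = f + d f) ∧ ∀ t ≤ T, dist (γ t) t < ε := by
  classical
  -- The time change has to fix `0`, so `0` joins the prescribed points.
  let F' := insert 0 F
  obtain ⟨g, hg, hgap⟩ : ∃ g : ℝ, 0 < g ∧ ∀ f ∈ F', ∀ f' ∈ F', f ≠ f' → g ≤ dist f f' := by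
    have h : ∀ᶠ g in 𝓝[>] (0 : ℝ), ∀ f ∈ F', ∀ f' ∈ F', f ≠ f' → g ≤ dist f f' := by
      rw [eventually_all_finset]; intro f _
      rw [eventually_all_finset]; intro f' _
      by_cases hff : f = f'
      · simp [hff]
      · filter_upwards [nhdsWithin_le_nhds (gt_mem_nhds (dist_pos.2 hff))] with g hg _ using hg.le
    obtain ⟨g, hg, hg0⟩ := (h.and self_mem_nhdsWithin).exists
    exact ⟨g, hg0, hg⟩
  -- A `K`-Lipschitz displacement with `K < 1` keeps the time change strictly increasing; `K T < ε`
  -- keeps it close to the identity on `[0, T]`.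
  obtain ⟨K, hK, hK1, hKT⟩ : ∃ K : ℝ≥0, 0 < K ∧ K < 1 ∧ K * (T : ℝ) < ε := by
    have h1 : ∀ᶠ K : ℝ≥0 in 𝓝[>] 0, (K : ℝ) * (T : ℝ) < ε := by
      apply nhdsWithin_le_nhds
      have : Tendsto (fun K : ℝ≥0 => (K : ℝ) * T) (𝓝 0) (𝓝 (((0 : ℝ≥0) : ℝ) * T)) :=
        (by fun_prop : Continuous fun K : ℝ≥0 => (K : ℝ) * T).tendsto _
      exact this.eventually_lt_const (by simpa using hε)
    have h2 : ∀ᶠ K in 𝓝[>] (0 : ℝ≥0), K < 1 := nhdsWithin_le_nhds (gt_mem_nhds one_pos)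
    obtain ⟨K, ⟨h1, h2⟩, h3⟩ := ((h1.and h2).and self_mem_nhdsWithin).exists
    exact ⟨K, h3, h2, h1⟩
  -- Two displacements then differ by at most `K g`, and distinct points are at least `g` apart, so
  -- `d` is `K`-Lipschitz on `F'` and extends to all times.
  refine ⟨K * g / 2, by positivity, fun d hd0 hd => ?_⟩
  have hd' : ∀ f ∈ F', |d f| ≤ K * g / 2 := by
    intro f hf
    rcases Finset.mem_insert.1 hf with rfl | hf
    · rw [hd0, abs_zero]; positivity
    · exact hd f hf
  have hlip : LipschitzOnWith K d (F' : Set ℝ≥0) := by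
    apply LipschitzOnWith.of_dist_le_mul
    intro f hf f' hf'
    by_cases hff : f = f'
    · simp [hff]
    · have h1 := hgap f hf f' hf' hff
      rw [Real.dist_eq]
      calc |d f - d f'| ≤ |d f| + |d f'| := abs_sub _ _
        _ ≤ K * g := by linarith [hd' f hf, hd' f' hf']
        _ ≤ K * dist f f' := by gcongr
  obtain ⟨φ, hφ, hφd⟩ := hlip.extend_real
  have hφ0 : φ 0 = 0 := by rw [← hφd (by simp [F']), hd0]
  have hφt : ∀ t, |φ t| ≤ K * t := fun t => by
    have := hφ.dist_le_mul t 0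
    rwa [hφ0, Real.dist_eq, sub_zero, NNReal.dist_eq, NNReal.coe_zero, sub_zero,
      NNReal.abs_eq] at this
  have hK1' : (K : ℝ) < 1 := by exact_mod_cast hK1
  have hnn : ∀ t : ℝ≥0, 0 ≤ (t : ℝ) + φ t := fun t => by
    have h1 := abs_le.1 (hφt t)
    nlinarith [t.2, h1.1]
  let γ : ℝ≥0 → ℝ≥0 := fun t => ⟨t + φ t, hnn t⟩
  have hγ : ∀ t, (γ t : ℝ) = t + φ t := fun t => rfl
  have hmono : StrictMono γ := by
    intro t u htu
    rw [← NNReal.coe_lt_coe, hγ, hγ]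
    have h1 := hφ.dist_le_mul t u
    have htu' : (t : ℝ) < u := htu
    rw [Real.dist_eq, NNReal.dist_eq, abs_sub_comm (t : ℝ), abs_of_pos (sub_pos.2 htu')] at h1
    have h2 := (abs_le.1 h1).2
    nlinarith [sub_pos.2 htu']
  have hcont : Continuous γ := by
    refine Continuous.subtype_mk ?_ _
    exact NNReal.continuous_coe.add hφ.continuous
  have hsurj : Function.Surjective γ := by
    intro u
    have h0 : γ 0 = 0 := by rw [← NNReal.coe_inj, hγ, hφ0]; simp
    obtain ⟨v, hv⟩ : ∃ v : ℝ≥0, u ≤ γ v := by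
      -- Since `γ v ≥ (1 - K) v`, this point is mapped beyond `u`.
      refine ⟨u / (1 - K), ?_⟩
      rw [← NNReal.coe_le_coe, hγ]
      have h1 := (abs_le.1 (hφt (u / (1 - K)))).1
      have h2 : ((u / (1 - K) : ℝ≥0) : ℝ) = u / (1 - K) := by
        rw [NNReal.coe_div, NNReal.coe_sub hK1.le, NNReal.coe_one]
      rw [h2] at h1 ⊢
      have h3 : (u : ℝ) / (1 - K) - K * (u / (1 - K)) = u := by
        have : (1 : ℝ) - K ≠ 0 := by linarith
        field_simp
      linarith
    obtain ⟨t, -, ht⟩ := intermediate_value_Icc (zero_le : 0 ≤ v) hcont.continuousOn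
      ⟨by rw [h0]; exact zero_le, hv⟩
    exact ⟨t, ht⟩
  refine ⟨hmono.orderIsoOfSurjective γ hsurj, fun f hf => ?_, fun t ht => ?_⟩
  · change (γ f : ℝ) = _
    rw [hγ, hφd (by simp [F', hf])]
  · change dist (γ t) t < ε
    rw [NNReal.dist_eq, hγ, add_sub_cancel_left]
    refine (hφt t).trans_lt (lt_of_le_of_lt ?_ hKT)
    gcongr

namespace SkorokhodSpace

/-- The time change moves each cut `f` to the first grid point at or after it. Then `f ≤ t` exactly
when `f` is at most the last grid point before or at `γ t`, so the sampled time lies in the same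
cell as `t`. -/
theorem tendsto_step {E : Type*} [PseudoMetricSpace E] (x : SkorokhodSpace E) :
    Tendsto (fun m : ℕ => step m fun k => x (k / ((m : ℝ≥0) + 1))) atTop (𝓝 x) := by
  rw [(hasBasis_nhds x).tendsto_right_iff]
  rintro ⟨T, ε⟩ hε
  obtain ⟨F, hF⟩ := x.exists_finset_dist_lt T hε
  obtain ⟨η, hη, h⟩ := exists_orderIso_eq_of_dist_le F T hε
  obtain ⟨m₀, hm₀⟩ := exists_nat_one_div_lt hη
  filter_upwards [eventually_ge_atTop m₀] with m hm
  have hm1 : (0 : ℝ≥0) < (m : ℝ≥0) + 1 := by positivity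
  have hm1' : (0 : ℝ) < (m : ℝ) + 1 := by positivity
  obtain ⟨γ, hγF, hγ⟩ := h (fun t => ⌈((m : ℝ≥0) + 1) * t⌉₊ / ((m : ℝ) + 1) - t) (by simp) (by
    intro f _
    have h1 : (((m : ℝ) + 1) * f : ℝ) ≤ ⌈((m : ℝ≥0) + 1) * f⌉₊ := by
      exact_mod_cast Nat.le_ceil (((m : ℝ≥0) + 1) * f)
    have h2 : (⌈((m : ℝ≥0) + 1) * f⌉₊ : ℝ) < (((m : ℝ) + 1) * f : ℝ) + 1 := by
      exact_mod_cast Nat.ceil_lt_add_one (zero_le : 0 ≤ ((m : ℝ≥0) + 1) * f)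
    have h3 : 1 / ((m : ℝ) + 1) ≤ η := by
      refine le_trans ?_ hm₀.le
      apply one_div_le_one_div_of_le (by positivity)
      have : (m₀ : ℝ) ≤ m := by exact_mod_cast hm
      linarith
    have h4 : (⌈((m : ℝ≥0) + 1) * f⌉₊ : ℝ) / ((m : ℝ) + 1) - f =
        ((⌈((m : ℝ≥0) + 1) * f⌉₊ : ℝ) - ((m : ℝ) + 1) * f) / ((m : ℝ) + 1) := by
      field_simp
    rw [h4, abs_of_nonneg (div_nonneg (by linarith) hm1'.le)]
    refine le_trans ?_ h3
    gcongr
    linarith)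
  refine ⟨γ, fun t ht => ⟨hγ t ht, hF t ht _ fun f hf => ?_⟩⟩
  have e : γ f = ⌈((m : ℝ≥0) + 1) * f⌉₊ / ((m : ℝ≥0) + 1) := by
    rw [← NNReal.coe_inj, hγF f hf]; push_cast; ring
  rw [← γ.le_iff_le, e, div_le_iff₀ hm1, mul_comm (γ t), ← Nat.le_floor_iff (by positivity),
    Nat.ceil_le, le_div_iff₀ hm1, mul_comm f]

/-- A random càdlàg path is Borel measurable as soon as its values are. -/
theorem measurable_of_eval {E : Type*} [PseudoMetricSpace E] [MeasurableSpace E] [BorelSpace E]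
    [SecondCountableTopology E] {Ω : Type*} [MeasurableSpace Ω] {X : Ω → SkorokhodSpace E}
    (hX : ∀ t, Measurable fun ω => X ω t) : Measurable X := by
  refine measurable_of_tendsto_metrizable (f := fun m ω => step m fun k => X ω (k / ((m : ℝ≥0) + 1)))
    (fun m => (continuous_step m).measurable.comp (measurable_pi_lambda _ fun k => hX _)) ?_
  rw [tendsto_pi_nhds]
  exact fun ω => tendsto_step (X ω)

/-- A càdlàg path is a Borel function of time. -/
theorem measurable_toFun {E : Type*} [PseudoMetricSpace E] [MeasurableSpace E] [BorelSpace E]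
    (x : SkorokhodSpace E) : Measurable x.toFun := by
  refine measurable_of_tendsto_metrizable
    -- Sampling at the grid point strictly to the right of `t` lets right continuity give the limit.
    (f := fun (m : ℕ) t => x (((⌊((m : ℝ≥0) + 1) * t⌋₊ + 1 : ℕ) : ℝ≥0) / ((m : ℝ≥0) + 1)))
    (fun m => ?_) ?_
  · exact (measurable_from_nat (f := fun k => x (((k + 1 : ℕ) : ℝ≥0) / ((m : ℝ≥0) + 1)))).comp
      (Nat.measurable_floor.comp (measurable_const.mul measurable_id))
  · rw [tendsto_pi_nhds]
    intro t
    refine Tendsto.comp (x.right_continuous t) (tendsto_nhdsWithin_iff.2 ⟨?_, ?_⟩)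
    · refine tendsto_of_tendsto_of_tendsto_of_le_of_le (g := fun _ => t)
        (h := fun m : ℕ => t + 1 / ((m : ℝ≥0) + 1)) tendsto_const_nhds ?_ ?_ ?_
      · simpa using tendsto_const_nhds.add (tendsto_one_div_add_atTop_nhds_zero_nat (𝕜 := ℝ≥0))
      · intro m
        dsimp only
        rw [le_div_iff₀ (by positivity), mul_comm]
        exact_mod_cast (Nat.lt_floor_add_one _).le
      · intro m
        dsimp only
        rw [div_le_iff₀ (by positivity), add_mul t, div_mul_cancel₀ _ (by positivity)]
        push_cast
        gcongr
        rw [mul_comm t]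
        exact Nat.floor_le (by positivity)
    · refine Eventually.of_forall fun m => ?_
      rw [mem_Ici, le_div_iff₀ (by positivity), mul_comm]
      exact_mod_cast (Nat.lt_floor_add_one _).le

end SkorokhodSpace

/-! ### Grönwall's inequality and global solutions of Lipschitz integral equations -/

/-- Grönwall's inequality in integral form. -/
theorem le_mul_exp_of_le_add_mul_integral {u : ℝ → ℝ} {a L T : ℝ} (hL : 0 ≤ L)
    (hT : 0 ≤ T) (hu : IntervalIntegrable u volume 0 T) (hu0 : ∀ t ∈ Icc 0 T, 0 ≤ u t)
    (h : ∀ t ∈ Icc 0 T, u t ≤ a + L * ∫ s in 0..t, u s) :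
    ∀ t ∈ Icc 0 T, u t ≤ a * Real.exp (L * t) := by
  have hint : Integrable ((Ioc 0 T).indicator u) :=
    ((intervalIntegrable_iff_integrableOn_Ioc_of_le hT).1 hu).integrable_indicator measurableSet_Ioc
  have heq : ∀ t ∈ Icc 0 T, ∫ s in 0..t, (Ioc 0 T).indicator u s = ∫ s in 0..t, u s := by
    intro t ht
    refine intervalIntegral.integral_congr_ae (Eventually.of_forall fun s hs => ?_)
    rw [uIoc_of_le ht.1] at hs
    exact indicator_of_mem (s := Ioc 0 T) ⟨hs.1, hs.2.trans ht.2⟩ u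
  -- The function `u` is merely integrable, so the differential form of Grönwall is applied to the
  -- primitive of the continuous majorant `f`. The indicator makes `f` continuous on the whole line.
  set f : ℝ → ℝ := fun t => a + L * ∫ s in 0..t, (Ioc 0 T).indicator u s with hf
  have hfc : Continuous f := continuous_const.add (continuous_const.mul
    (intervalIntegral.continuous_primitive (fun _ _ => hint.intervalIntegrable) 0))
  have huf : ∀ t ∈ Icc 0 T, u t ≤ f t := fun t ht => by
    rw [hf]; dsimp only; rw [heq t ht]; exact h t ht
  have hf0 : ∀ t ∈ Icc 0 T, 0 ≤ f t := fun t ht => (hu0 t ht).trans (huf t ht)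
  have hfG : ∀ t ∈ Icc 0 T, f t ≤ L * (∫ s in 0..t, f s) + a := by
    intro t ht
    have : ∫ s in 0..t, u s ≤ ∫ s in 0..t, f s := by
      refine intervalIntegral.integral_mono_on ht.1 (hu.mono_set ?_) (hfc.intervalIntegrable _ _)
        fun s hs => huf s ⟨hs.1, hs.2.trans ht.2⟩
      rw [uIcc_of_le ht.1, uIcc_of_le hT]
      exact Icc_subset_Icc_right ht.2
    have := mul_le_mul_of_nonneg_left this hL
    rw [hf]; dsimp only; rw [heq t ht]
    linarith
  have hG0 : ∀ t ∈ Icc 0 T, 0 ≤ ∫ s in 0..t, f s := fun t ht =>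
    intervalIntegral.integral_nonneg ht.1 fun s hs => hf0 s ⟨hs.1, hs.2.trans ht.2⟩
  have hG : ∀ t ∈ Icc 0 T, ‖∫ s in 0..t, f s‖ ≤ gronwallBound 0 L a (t - 0) := by
    refine norm_le_gronwallBound_of_norm_deriv_right_le (f' := f)
      (intervalIntegral.continuous_primitive (fun _ _ => hfc.intervalIntegrable _ _) 0).continuousOn
      (fun t _ => (intervalIntegral.integral_hasDerivAt_right (hfc.intervalIntegrable _ _)
        hfc.aestronglyMeasurable.stronglyMeasurableAtFilter hfc.continuousAt).hasDerivWithinAt)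
      (by simp) ?_
    intro t ht
    have ht' := Ico_subset_Icc_self ht
    rw [Real.norm_of_nonneg (hf0 t ht'), Real.norm_of_nonneg (hG0 t ht')]
    exact hfG t ht'
  intro t ht
  have h1 := hG t ht
  rw [Real.norm_of_nonneg (hG0 t ht), sub_zero] at h1
  refine (huf t ht).trans ((hfG t ht).trans ?_)
  rcases eq_or_ne L 0 with rfl | hL0
  · simp
  · rw [gronwallBound_of_K_ne_0 hL0] at h1
    calc L * (∫ s in 0..t, f s) + a ≤ L * (0 * Real.exp (L * t) + a / L * (Real.exp (L * t) - 1)) + a := by gcongr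
      _ = a * Real.exp (L * t) := by field_simp; ring

theorem integral_exp_mul_le {K t : ℝ} (hK : 0 < K) :
    ∫ u in 0..t, Real.exp (K * u) ≤ Real.exp (K * t) / K := by
  rw [intervalIntegral.integral_comp_mul_left _ hK.ne', integral_exp, smul_eq_mul, mul_zero,
    Real.exp_zero, div_eq_inv_mul]
  gcongr
  linarith

/-- Global existence for an autonomous Lipschitz equation in integral form. -/
theorem exists_continuous_eq_add_integral {E : Type*} [NormedAddCommGroup E] [NormedSpace ℝ E]
    [CompleteSpace E] {f : E → E} {L : ℝ≥0} (hf : LipschitzWith L f) (z₀ : E) :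
    ∃ z : ℝ≥0 → E, Continuous z ∧
      ∀ t : ℝ≥0, z t = z₀ + ∫ u in (0 : ℝ)..t, f (z u.toNNReal) := by
  -- Weighting by `exp (-K t)` turns the Picard operator into a contraction of ratio `L / K < 1` on
  -- bounded continuous functions on the whole half-line, so no local solutions need gluing. The
  -- unknown `g` stands for `exp (-K t) z t`.
  set K : ℝ := L + 1 with hKdef
  have hK : 0 < K := by positivity
  let G (g : BoundedContinuousFunction ℝ≥0 E) (u : ℝ) : E :=
    f (Real.exp (K * u) • g u.toNNReal)
  have hGc (g) : Continuous (G g) := by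
    refine hf.continuous.comp (Continuous.smul (by fun_prop) ?_)
    exact g.continuous.comp continuous_real_toNNReal
  let Ψ (g : BoundedContinuousFunction ℝ≥0 E) (t : ℝ≥0) : E :=
    Real.exp (-(K * t)) • (z₀ + ∫ u in (0 : ℝ)..t, G g u)
  have hΨc (g) : Continuous (Ψ g) := by
    have h1 : Continuous fun t : ℝ => Real.exp (-(K * t)) • (z₀ + ∫ u in (0 : ℝ)..t, G g u) :=
      Continuous.smul (by fun_prop) (continuous_const.add
        (intervalIntegral.continuous_primitive (fun _ _ => (hGc g).intervalIntegrable _ _) 0))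
    exact h1.comp NNReal.continuous_coe
  have hint (C : ℝ) (hC : 0 ≤ C) (H : ℝ → E) (t : ℝ≥0)
      (hH : ∀ u : ℝ, 0 ≤ u → ‖H u‖ ≤ C * Real.exp (K * u)) :
      Real.exp (-(K * t)) * ‖∫ u in (0 : ℝ)..t, H u‖ ≤ C / K := by
    have h1 : ‖∫ u in (0 : ℝ)..t, H u‖ ≤ ∫ u in (0 : ℝ)..t, C * Real.exp (K * u) :=
      intervalIntegral.norm_integral_le_of_norm_le t.2
        (Eventually.of_forall fun u hu => hH u hu.1.le)
        (Continuous.intervalIntegrable (by fun_prop) _ _)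
    rw [intervalIntegral.integral_const_mul] at h1
    have h2 := mul_le_mul_of_nonneg_left (integral_exp_mul_le (t := t) hK) hC
    calc Real.exp (-(K * t)) * ‖∫ u in (0 : ℝ)..t, H u‖
        ≤ Real.exp (-(K * t)) * (C * (Real.exp (K * t) / K)) := by gcongr; exact h1.trans h2
      _ = (Real.exp (-(K * t)) * Real.exp (K * t)) * (C / K) := by ring
      _ = C / K := by rw [← Real.exp_add]; simp
  have hΨb (g) : ∀ t, ‖Ψ g t‖ ≤ ‖z₀‖ + (‖f 0‖ + L * ‖g‖) / K := by
    intro t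
    have h1 := hint (‖f 0‖ + L * ‖g‖) (by positivity) (G g) t (by
      intro u hu
      have h2 := hf.dist_le_mul (Real.exp (K * u) • g u.toNNReal) 0
      rw [dist_eq_norm, dist_zero_right, norm_smul, Real.norm_of_nonneg (Real.exp_pos _).le] at h2
      have h3 : ‖G g u‖ ≤ ‖f 0‖ + L * (Real.exp (K * u) * ‖g u.toNNReal‖) := by
        calc ‖G g u‖ = ‖f 0 + (G g u - f 0)‖ := by simp
          _ ≤ ‖f 0‖ + ‖G g u - f 0‖ := norm_add_le _ _
          _ ≤ _ := by gcongr
      have h4 : ‖g u.toNNReal‖ ≤ ‖g‖ := g.norm_coe_le_norm _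
      have h5 : 1 ≤ Real.exp (K * u) := Real.one_le_exp (by positivity)
      calc ‖G g u‖ ≤ ‖f 0‖ + L * (Real.exp (K * u) * ‖g u.toNNReal‖) := h3
        _ ≤ ‖f 0‖ * Real.exp (K * u) + L * (Real.exp (K * u) * ‖g‖) := by
            gcongr
            exact le_mul_of_one_le_right (norm_nonneg _) h5
        _ = _ := by ring)
    have h2 : Real.exp (-(K * t)) ≤ 1 := Real.exp_le_one_iff.2 (by
      have : 0 ≤ K * (t : ℝ) := by positivity
      linarith)
    calc ‖Ψ g t‖ = Real.exp (-(K * t)) * ‖z₀ + ∫ u in (0 : ℝ)..t, G g u‖ := by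
          rw [norm_smul, Real.norm_of_nonneg (Real.exp_pos _).le]
      _ ≤ Real.exp (-(K * t)) * (‖z₀‖ + ‖∫ u in (0 : ℝ)..t, G g u‖) := by
          gcongr; exact norm_add_le _ _
      _ = Real.exp (-(K * t)) * ‖z₀‖ + Real.exp (-(K * t)) * ‖∫ u in (0 : ℝ)..t, G g u‖ := by ring
      _ ≤ _ := by
          gcongr
          exact mul_le_of_le_one_left (norm_nonneg _) h2
  let Φ (g : BoundedContinuousFunction ℝ≥0 E) : BoundedContinuousFunction ℝ≥0 E :=
    BoundedContinuousFunction.ofNormedAddCommGroup (Ψ g) (hΨc g) _ (hΨb g)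
  have hΦ : ContractingWith (L / (L + 1)) Φ := by
    refine ⟨by rw [div_lt_one (by positivity)]; exact lt_add_one L,
      LipschitzWith.of_dist_le_mul fun g h => ?_⟩
    rw [BoundedContinuousFunction.dist_le (by positivity)]
    intro t
    have h1 := hint (L * dist g h) (by positivity) (fun u => G g u - G h u) t (by
      intro u hu
      rw [← dist_eq_norm]
      refine (hf.dist_le_mul _ _).trans ?_
      rw [dist_eq_norm, ← smul_sub, norm_smul, Real.norm_of_nonneg (Real.exp_pos _).le,
        ← dist_eq_norm]
      have : dist (g u.toNNReal) (h u.toNNReal) ≤ dist g h :=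
        BoundedContinuousFunction.dist_coe_le_dist _
      calc (L : ℝ) * (Real.exp (K * u) * dist (g u.toNNReal) (h u.toNNReal))
          ≤ L * (Real.exp (K * u) * dist g h) := by gcongr
        _ = _ := by ring)
    rw [intervalIntegral.integral_sub ((hGc g).intervalIntegrable _ _)
      ((hGc h).intervalIntegrable _ _)] at h1
    change dist (Ψ g t) (Ψ h t) ≤ _
    rw [dist_eq_norm, ← smul_sub, norm_smul, Real.norm_of_nonneg (Real.exp_pos _).le,
      add_sub_add_left_eq_sub]
    refine h1.trans (le_of_eq ?_)
    push_cast
    rw [hKdef]; ring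
  have hfix := hΦ.fixedPoint_isFixedPt
  set g := ContractingWith.fixedPoint Φ hΦ
  have hg : ∀ t, g t = Ψ g t := fun t => by
    conv_lhs => rw [← hfix]
    rfl
  refine ⟨fun t => Real.exp (K * t) • g t, Continuous.smul (by fun_prop) g.continuous, fun t => ?_⟩
  dsimp only
  rw [hg t, smul_smul, ← Real.exp_add, add_neg_cancel, Real.exp_zero, one_smul]
  congr 1
  refine intervalIntegral.integral_congr fun u hu => ?_
  rw [uIcc_of_le t.coe_nonneg] at hu
  simp only [G, Real.coe_toNNReal u hu.1]

/-! ### The fluid equations: Lipschitz drift, well-posedness and stability -/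

/-- The vector field of the fluid equations. -/
noncomputable def drift (prm : CallCenterParams) (x : Fin 3 → ℝ) : Fin 3 → ℝ :=
  ![prm.lam + prm.deltaRD * x 1 + prm.deltaRC * x 2 - prm.mu * min (prm.s : ℝ) (x 0)
      - prm.theta * max (x 0 - prm.s) 0,
    prm.p * prm.theta * max (x 0 - prm.s) 0 - prm.deltaRD * x 1,
    prm.q * prm.mu * min (prm.s : ℝ) (x 0) - prm.deltaRC * x 2]

/-- A Lipschitz constant of the drift, for the sup norm. -/
noncomputable def driftLipschitz (prm : CallCenterParams) : ℝ≥0 :=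
  prm.deltaRD + prm.deltaRC + prm.mu + prm.theta

/-- Each rate enters a coordinate at most once, multiplied by a 1-Lipschitz function of one
coordinate and possibly by `p` or `q`, which are at most `1`. -/
theorem lipschitzWith_drift (prm : CallCenterParams) :
    LipschitzWith (driftLipschitz prm) (drift prm) := by
  refine LipschitzWith.of_dist_le_mul fun x y => ?_
  rw [dist_pi_le_iff (by positivity)]
  have h0 : |x 0 - y 0| ≤ dist x y := dist_le_pi_dist x y 0
  have h1 : |x 1 - y 1| ≤ dist x y := dist_le_pi_dist x y 1
  have h2 : |x 2 - y 2| ≤ dist x y := dist_le_pi_dist x y 2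
  have hmin : |min (prm.s : ℝ) (x 0) - min (prm.s : ℝ) (y 0)| ≤ dist x y :=
    (abs_min_sub_min_le_max _ _ _ _).trans (by simpa using h0)
  have hmax : |max (x 0 - prm.s) 0 - max (y 0 - prm.s) 0| ≤ dist x y :=
    (abs_max_sub_max_le_max _ _ _ _).trans (by simpa using h0)
  have hc : ∀ (c : ℝ≥0) (a : ℝ), |a| ≤ dist x y → |c * a| ≤ c * dist x y := fun c a h => by
    rw [abs_mul, NNReal.abs_eq]; gcongr
  have hpc : ∀ (r : unitInterval) (c : ℝ≥0) (a : ℝ), |a| ≤ dist x y →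
      |(r : ℝ) * c * a| ≤ c * dist x y := fun r c a h => by
    rw [mul_assoc, abs_mul, abs_of_nonneg r.2.1]
    exact (mul_le_of_le_one_left (abs_nonneg _) r.2.2).trans (hc c a h)
  have a1 := abs_le.1 (hc prm.deltaRD _ h1)
  have a2 := abs_le.1 (hc prm.deltaRC _ h2)
  have a3 := abs_le.1 (hc prm.mu _ hmin)
  have a4 := abs_le.1 (hc prm.theta _ hmax)
  have a5 := abs_le.1 (hpc prm.p prm.theta _ hmax)
  have a6 := abs_le.1 (hpc prm.q prm.mu _ hmin)
  have e : (driftLipschitz prm : ℝ) * dist x y = prm.deltaRD * dist x y + prm.deltaRC * dist x y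
      + prm.mu * dist x y + prm.theta * dist x y := by
    rw [driftLipschitz]; push_cast; ring
  have n1 : 0 ≤ prm.deltaRD * dist x y := by positivity
  have n2 : 0 ≤ prm.deltaRC * dist x y := by positivity
  have n3 : 0 ≤ prm.mu * dist x y := by positivity
  have n4 : 0 ≤ prm.theta * dist x y := by positivity
  intro i
  rw [e, Real.dist_eq, abs_le]
  fin_cases i <;> simp only [drift, Fin.reduceFinMk, Fin.zero_eta, Fin.mk_one, Matrix.cons_val] <;>
    constructor <;> linarith

section Integral

variable {prm : CallCenterParams} {x : ℝ≥0 → Fin 3 → ℝ} {t : ℝ≥0}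

theorem intervalIntegrable_min
    (hx : IntervalIntegrable (fun u : ℝ => x u.toNNReal 0) volume 0 t) :
    IntervalIntegrable (fun u : ℝ => min (prm.s : ℝ) (x u.toNNReal 0)) volume 0 t := by
  rw [intervalIntegrable_iff] at hx ⊢
  exact Integrable.inf (by simp) hx

theorem intervalIntegrable_max
    (hx : IntervalIntegrable (fun u : ℝ => x u.toNNReal 0) volume 0 t) :
    IntervalIntegrable (fun u : ℝ => max (x u.toNNReal 0 - prm.s) 0) volume 0 t := by
  rw [intervalIntegrable_iff] at hx ⊢
  exact (Integrable.sub hx (by simp)).pos_part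

theorem timeIntegral_drift_zero
    (hx : ∀ i, IntervalIntegrable (fun u : ℝ => x u.toNNReal i) volume 0 t) :
    timeIntegral (fun u => drift prm (x u) 0) t = prm.lam * t
      + prm.deltaRD * timeIntegral (fun u => x u 1) t
      + prm.deltaRC * timeIntegral (fun u => x u 2) t
      - prm.mu * timeIntegral (fun u => min (prm.s : ℝ) (x u 0)) t
      - prm.theta * timeIntegral (fun u => max (x u 0 - prm.s) 0) t := by
  have hc : IntervalIntegrable (fun _ : ℝ => (prm.lam : ℝ)) volume 0 t := by simp
  have h1 := (hx 1).const_mul (prm.deltaRD : ℝ)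
  have h2 := (hx 2).const_mul (prm.deltaRC : ℝ)
  have h3 := (intervalIntegrable_min (prm := prm) (hx 0)).const_mul (prm.mu : ℝ)
  have h4 := (intervalIntegrable_max (prm := prm) (hx 0)).const_mul (prm.theta : ℝ)
  simp only [timeIntegral, drift, Matrix.cons_val]
  rw [intervalIntegral.integral_sub (((hc.add h1).add h2).sub h3) h4,
    intervalIntegral.integral_sub ((hc.add h1).add h2) h3,
    intervalIntegral.integral_add (hc.add h1) h2, intervalIntegral.integral_add hc h1]
  simp only [intervalIntegral.integral_const_mul, intervalIntegral.integral_const, sub_zero,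
    smul_eq_mul]
  ring

theorem timeIntegral_drift_one
    (hx : ∀ i, IntervalIntegrable (fun u : ℝ => x u.toNNReal i) volume 0 t) :
    timeIntegral (fun u => drift prm (x u) 1) t =
      prm.p * prm.theta * timeIntegral (fun u => max (x u 0 - prm.s) 0) t
      - prm.deltaRD * timeIntegral (fun u => x u 1) t := by
  have h1 := (hx 1).const_mul (prm.deltaRD : ℝ)
  have h4 := (intervalIntegrable_max (prm := prm) (hx 0)).const_mul (prm.p * prm.theta : ℝ)
  simp only [timeIntegral, drift, Matrix.cons_val]
  rw [intervalIntegral.integral_sub h4 h1]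
  simp only [intervalIntegral.integral_const_mul]

theorem timeIntegral_drift_two
    (hx : ∀ i, IntervalIntegrable (fun u : ℝ => x u.toNNReal i) volume 0 t) :
    timeIntegral (fun u => drift prm (x u) 2) t =
      prm.q * prm.mu * timeIntegral (fun u => min (prm.s : ℝ) (x u 0)) t
      - prm.deltaRC * timeIntegral (fun u => x u 2) t := by
  have h2 := (hx 2).const_mul (prm.deltaRC : ℝ)
  have h3 := (intervalIntegrable_min (prm := prm) (hx 0)).const_mul (prm.q * prm.mu : ℝ)
  simp only [timeIntegral, drift, Matrix.cons_val]
  rw [intervalIntegral.integral_sub h3 h2]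
  simp only [intervalIntegral.integral_const_mul]

end Integral

theorem isFluidSolution_iff {prm : CallCenterParams} {z₀ : Fin 3 → ℝ} {z : ℝ≥0 → Fin 3 → ℝ} :
    IsFluidSolution prm z₀ z ↔
      (∀ (i : Fin 3) (t : ℝ≥0), IntervalIntegrable (fun u : ℝ => z u.toNNReal i) volume 0 t) ∧
      ∀ t i, z t i = z₀ i + timeIntegral (fun u => drift prm (z u) i) t := by
  constructor
  · intro h
    refine ⟨h.integrable, fun t i => ?_⟩
    have hi := fun i => h.integrable i t
    fin_cases i
    · simp only [Fin.zero_eta]; rw [timeIntegral_drift_zero hi, h.eq_Q t]; ring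
    · simp only [Fin.mk_one]; rw [timeIntegral_drift_one hi, h.eq_RD t]; ring
    · simp only [Fin.reduceFinMk]; rw [timeIntegral_drift_two hi, h.eq_RC t]; ring
  · rintro ⟨hi, h⟩
    refine ⟨hi, fun t => ?_, fun t => ?_, fun t => ?_⟩
    · rw [h, timeIntegral_drift_zero fun i => hi i t]; ring
    · rw [h, timeIntegral_drift_one fun i => hi i t]; ring
    · rw [h, timeIntegral_drift_two fun i => hi i t]; ring

theorem exists_isFluidSolution (prm : CallCenterParams) (z₀ : Fin 3 → ℝ) :
    ∃ z : ℝ≥0 → Fin 3 → ℝ, Continuous z ∧ IsFluidSolution prm z₀ z := by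
  obtain ⟨z, hz, h⟩ := exists_continuous_eq_add_integral (lipschitzWith_drift prm) z₀
  have hc : Continuous fun u : ℝ => z u.toNNReal := hz.comp continuous_real_toNNReal
  refine ⟨z, hz, isFluidSolution_iff.2 ⟨fun i t =>
    ((continuous_apply i).comp hc).intervalIntegrable _ _, fun t i => ?_⟩⟩
  conv_lhs => rw [h t]
  rw [Pi.add_apply]
  congr 1
  exact ((ContinuousLinearMap.proj (R := ℝ) (φ := fun _ : Fin 3 => ℝ) i).intervalIntegral_comp_comm
    (((lipschitzWith_drift prm).continuous.comp hc).intervalIntegrable _ _)).symm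

/-- Stability of the fluid equations: approximate solutions are close. -/
theorem dist_le_of_approx_fluid (prm : CallCenterParams) {x y : ℝ≥0 → Fin 3 → ℝ} {T : ℝ≥0} {a : ℝ}
    (ha : 0 ≤ a)
    (hx : ∀ i, IntervalIntegrable (fun u : ℝ => x u.toNNReal i) volume 0 T)
    (hy : ∀ i, IntervalIntegrable (fun u : ℝ => y u.toNNReal i) volume 0 T)
    (h : ∀ t ≤ T, ∀ i, |x t i - y t i - (timeIntegral (fun u => drift prm (x u) i) t
      - timeIntegral (fun u => drift prm (y u) i) t)| ≤ a) :
    ∀ t ≤ T, dist (x t) (y t) ≤ a * Real.exp (driftLipschitz prm * t) := by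
  have hvec : ∀ {w : ℝ≥0 → Fin 3 → ℝ},
      (∀ i, IntervalIntegrable (fun u : ℝ => w u.toNNReal i) volume 0 T) →
      IntervalIntegrable (fun u : ℝ => w u.toNNReal) volume 0 T := fun hw => by
    rw [intervalIntegrable_iff]
    exact Integrable.of_eval fun i => intervalIntegrable_iff.1 (hw i)
  have hF : ∀ {w : ℝ≥0 → Fin 3 → ℝ},
      (∀ i, IntervalIntegrable (fun u : ℝ => w u.toNNReal i) volume 0 T) → ∀ i,
      IntervalIntegrable (fun u : ℝ => drift prm (w u.toNNReal) i) volume 0 T := fun hw i => by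
    have c : IntervalIntegrable (fun _ : ℝ => (prm.lam : ℝ)) volume 0 T := by simp
    have h1 := fun c : ℝ => (hw 1).const_mul c
    have h2 := fun c : ℝ => (hw 2).const_mul c
    have h3 := fun c : ℝ => (intervalIntegrable_min (prm := prm) (hw 0)).const_mul c
    have h4 := fun c : ℝ => (intervalIntegrable_max (prm := prm) (hw 0)).const_mul c
    fin_cases i
    · exact (((c.add (h1 _)).add (h2 _)).sub (h3 _)).sub (h4 _)
    · exact (h4 _).sub (h1 _)
    · exact (h3 _).sub (h2 _)
  have hd : IntervalIntegrable (fun u : ℝ => dist (x u.toNNReal) (y u.toNNReal)) volume 0 T := by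
    simp only [dist_eq_norm]
    exact ((hvec hx).sub (hvec hy)).norm
  have key := le_mul_exp_of_le_add_mul_integral (L := driftLipschitz prm) (by positivity) T.2 hd
    (fun _ _ => dist_nonneg) (by
    intro t ht
    have sub : uIcc 0 t ⊆ uIcc 0 (T : ℝ) := by
      rw [uIcc_of_le ht.1, uIcc_of_le T.coe_nonneg]; exact Icc_subset_Icc_right ht.2
    have hdt := (hd.mono_set sub).const_mul (driftLipschitz prm : ℝ)
    have h0 : 0 ≤ ∫ u in 0..t, dist (x u.toNNReal) (y u.toNNReal) :=
      intervalIntegral.integral_nonneg ht.1 fun _ _ => dist_nonneg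
    rw [dist_pi_le_iff (by positivity)]
    intro i
    have h1 := h t.toNNReal (Real.toNNReal_le_iff_le_coe.2 ht.2) i
    simp only [timeIntegral, Real.coe_toNNReal t ht.1] at h1
    rw [← intervalIntegral.integral_sub ((hF hx i).mono_set sub) ((hF hy i).mono_set sub)] at h1
    have h2 : |∫ u in 0..t, (drift prm (x u.toNNReal) i - drift prm (y u.toNNReal) i)| ≤
        ∫ u in 0..t, driftLipschitz prm * dist (x u.toNNReal) (y u.toNNReal) := by
      rw [← Real.norm_eq_abs]
      exact intervalIntegral.norm_integral_le_of_norm_le ht.1 (Eventually.of_forall fun u _ =>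
        (dist_le_pi_dist _ _ i).trans ((lipschitzWith_drift prm).dist_le_mul _ _)) hdt
    rw [intervalIntegral.integral_const_mul] at h2
    rw [Real.dist_eq]
    have h3 := abs_sub_abs_le_abs_sub (x t.toNNReal i - y t.toNNReal i)
      (∫ u in 0..t, (drift prm (x u.toNNReal) i - drift prm (y u.toNNReal) i))
    linarith)
  intro t ht
  simpa using key t ⟨t.2, ht⟩

/-- Stability with error `a = 0`; local integrability of the two solutions is enough. -/
theorem IsFluidSolution.unique {prm : CallCenterParams} {z₀ : Fin 3 → ℝ} {z w : ℝ≥0 → Fin 3 → ℝ}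
    (hz : IsFluidSolution prm z₀ z) (hw : IsFluidSolution prm z₀ w) : w = z := by
  ext1 T
  have hz' := isFluidSolution_iff.1 hz
  have hw' := isFluidSolution_iff.1 hw
  have h := dist_le_of_approx_fluid prm le_rfl (fun i => hw'.1 i T) (fun i => hz'.1 i T)
    (fun t _ i => by rw [hw'.2 t i, hz'.2 t i]; simp) T le_rfl
  rw [zero_mul] at h
  exact dist_le_zero.1 h

/-! ### Events of probability tending to one, and convergence in distribution to a constant -/

section WithHighProbability

variable {ι : Type*} {Ω : ι → Type*} [∀ n, MeasurableSpace (Ω n)] {P : ∀ n, Measure (Ω n)}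
  {l : Filter ι}

/-- The probability that the property fails tends to `0`. The property need not be measurable. -/
def WithHighProbability (P : ∀ n, Measure (Ω n)) (l : Filter ι) (A : ∀ n, Ω n → Prop) : Prop :=
  Tendsto (fun n => P n {ω | ¬ A n ω}) l (𝓝 0)

theorem WithHighProbability.mono {A B : ∀ n, Ω n → Prop} (hA : WithHighProbability P l A)
    (h : ∀ᶠ n in l, ∀ᵐ ω ∂P n, A n ω → B n ω) : WithHighProbability P l B := by
  refine tendsto_of_tendsto_of_tendsto_of_le_of_le' tendsto_const_nhds hA
    (Eventually.of_forall fun _ => zero_le) ?_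
  filter_upwards [h] with n hn
  refine measure_mono_ae ?_
  filter_upwards [hn] with ω hω hB hA using hB (hω hA)

theorem WithHighProbability.and {A B : ∀ n, Ω n → Prop} (hA : WithHighProbability P l A)
    (hB : WithHighProbability P l B) : WithHighProbability P l fun n ω => A n ω ∧ B n ω := by
  have h := Tendsto.add hA hB
  rw [add_zero] at h
  refine tendsto_of_tendsto_of_tendsto_of_le_of_le tendsto_const_nhds h (fun _ => zero_le)
    fun n => ?_
  refine (measure_mono ?_).trans (measure_union_le _ _)
  intro ω hω
  by_cases h : A n ω
  · exact Or.inr fun hb => hω ⟨h, hb⟩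
  · exact Or.inl h

theorem WithHighProbability.of_ae {A : ∀ n, Ω n → Prop} (h : ∀ n, ∀ᵐ ω ∂P n, A n ω) :
    WithHighProbability P l A := by
  have : (fun n => P n {ω | ¬ A n ω}) = fun _ => 0 := funext fun n => ae_iff.1 (h n)
  rw [WithHighProbability, this]
  exact tendsto_const_nhds

theorem WithHighProbability.forall_finset {κ : Type*} (s : Finset κ) {A : κ → ∀ n, Ω n → Prop}
    (h : ∀ i ∈ s, WithHighProbability P l (A i)) :
    WithHighProbability P l fun n ω => ∀ i ∈ s, A i n ω := by
  classical
  induction s using Finset.induction_on with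
  | empty => exact .of_ae fun n => by simp
  | insert i s _ ih =>
    refine ((h i (by simp)).and (ih fun j hj => h j (by simp [hj]))).mono ?_
    refine Eventually.of_forall fun n => Eventually.of_forall fun ω hω j hj => ?_
    rcases Finset.mem_insert.1 hj with rfl | hj
    exacts [hω.1, hω.2 j hj]

/-- Monotone random functions which are pointwise close to a linear function are uniformly close
to it on bounded sets. -/
theorem WithHighProbability.forall_le_of_monotone {X : ∀ n, ℝ≥0 → Ω n → ℝ} {c : ℝ≥0}
    (hmono : ∀ n, ∀ᵐ ω ∂P n, Monotone fun x => X n x ω)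
    (h : ∀ x : ℝ≥0, ∀ ε > 0, WithHighProbability P l fun n ω => |X n x ω - c * x| < ε)
    (K : ℝ≥0) {ε : ℝ} (hε : 0 < ε) :
    WithHighProbability P l fun n ω => ∀ x ≤ K, |X n x ω - c * x| < ε := by
  -- Over one mesh `δ` the linear function grows by at most `ε / 2`; the grid values contribute the
  -- other `ε / 2`, and monotonicity fills the gaps.
  obtain ⟨δ, hδ, hcδ⟩ : ∃ δ : ℝ≥0, 0 < δ ∧ (c : ℝ) * δ ≤ ε / 2 := by
    refine ⟨(ε / (2 * (c + 1))).toNNReal, Real.toNNReal_pos.2 (by positivity), ?_⟩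
    · rw [Real.coe_toNNReal _ (by positivity)]
      rw [mul_div_assoc', div_le_div_iff₀ (by positivity) (by positivity)]
      nlinarith [c.2]
  refine ((WithHighProbability.of_ae (l := l) hmono).and (forall_finset
    -- The grid has to contain the right neighbour `⌊x / δ⌋₊ + 1` of every `x ≤ K`.
    (Finset.range (⌊K / δ⌋₊ + 2)) fun i _ => h (i * δ) (ε / 2) (half_pos hε))).mono ?_
  refine Eventually.of_forall fun n => Eventually.of_forall ?_
  rintro ω ⟨hm, hω⟩ x hx
  have hi : ⌊x / δ⌋₊ ≤ ⌊K / δ⌋₊ := Nat.floor_le_floor (by gcongr)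
  have h1 := abs_lt.1 (hω ⌊x / δ⌋₊ (by rw [Finset.mem_range]; omega))
  have h2 := abs_lt.1 (hω (⌊x / δ⌋₊ + 1) (by rw [Finset.mem_range]; omega))
  have l1 : (⌊x / δ⌋₊ : ℝ≥0) * δ ≤ x := by
    rw [← le_div_iff₀ hδ]; exact Nat.floor_le (by positivity)
  have l2 : x ≤ ((⌊x / δ⌋₊ + 1 : ℕ) : ℝ≥0) * δ := by
    rw [← div_le_iff₀ hδ]; exact_mod_cast (Nat.lt_floor_add_one _).le
  have m1 := hm l1
  have m2 := hm l2
  have l1' : (⌊x / δ⌋₊ : ℝ) * δ ≤ x := by exact_mod_cast l1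
  have l2' : (x : ℝ) ≤ ((⌊x / δ⌋₊ : ℝ) + 1) * δ := by exact_mod_cast l2
  push_cast at h1 h2 m1 m2
  have e1 := mul_le_mul_of_nonneg_left l1' c.coe_nonneg
  have e2 := mul_le_mul_of_nonneg_left l2' c.coe_nonneg
  rw [abs_lt]
  constructor <;> nlinarith [h1.1, h2.2]

section InDistribution

variable [∀ n, IsProbabilityMeasure (P n)] {E : Type*} [TopologicalSpace E] [MeasurableSpace E]
  {X : ∀ n, Ω n → E} {z : E}

/-- Portmanteau for the closed set `Uᶜ`, which has limit mass zero. -/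
theorem MeasureTheory.TendstoInDistribution.withHighProbability [OpensMeasurableSpace E]
    [HasOuterApproxClosed E]
    (h : TendstoInDistribution X l (fun _ : Unit => z) P (Measure.dirac ())) {U : Set E}
    (hU : IsOpen U) (hz : z ∈ U) : WithHighProbability P l fun n ω => X n ω ∈ U := by
  have h1 := ProbabilityMeasure.limsup_measure_closed_le_of_tendsto h.tendsto hU.isClosed_compl
  simp only [ProbabilityMeasure.coe_mk] at h1
  rw [Measure.map_apply measurable_const hU.measurableSet.compl] at h1
  have h2 : (fun _ : Unit => z) ⁻¹' Uᶜ = ∅ := by ext; simp [hz]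
  rw [h2, measure_empty] at h1
  have h3 : ∀ n, (P n).map (X n) Uᶜ = P n {ω | ¬ X n ω ∈ U} := fun n =>
    Measure.map_apply_of_aemeasurable (h.forall_aemeasurable n) hU.measurableSet.compl
  simp only [h3] at h1
  exact tendsto_of_le_liminf_of_limsup_le zero_le h1

/-- Portmanteau for open sets `G`: the probabilities tend to `1` if `z ∈ G`, and otherwise the lower
bound to be shown is `0`. -/
theorem tendstoInDistribution_of_withHighProbability [OpensMeasurableSpace E]
    (hX : ∀ n, AEMeasurable (X n) (P n)) [l.IsCountablyGenerated]
    (h : ∀ U ∈ 𝓝 z, WithHighProbability P l fun n ω => X n ω ∈ U) :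
    TendstoInDistribution X l (fun _ : Unit => z) P (Measure.dirac ()) where
  forall_aemeasurable := hX
  aemeasurable_limit := aemeasurable_const
  tendsto := by
    refine tendsto_of_forall_isOpen_le_liminf' fun G hG => ?_
    rcases l.eq_or_neBot with rfl | hl
    · simp [liminf_bot]
    simp only [ProbabilityMeasure.coe_mk]
    rw [Measure.map_apply measurable_const hG.measurableSet]
    by_cases hz : z ∈ G
    · have h1 := h G (hG.mem_nhds hz)
      have h3 : ∀ n, (P n).map (X n) G = 1 - P n {ω | ¬ X n ω ∈ G} := fun n => by
        have := Measure.isProbabilityMeasure_map (hX n)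
        rw [← compl_compl G, prob_compl_eq_one_sub hG.measurableSet.compl,
          Measure.map_apply_of_aemeasurable (hX n) hG.measurableSet.compl, compl_compl]
        rfl
      simp only [h3]
      have h4 := ENNReal.Tendsto.sub (tendsto_const_nhds (x := (1 : ENNReal))) h1 (by simp)
      rw [h4.liminf_eq, tsub_zero]
      exact prob_le_one
    · have h2 : (fun _ : Unit => z) ⁻¹' G = ∅ := by ext; simp [hz]
      rw [h2, measure_empty]
      exact zero_le

end InDistribution

end WithHighProbability

/-! ### Laws of large numbers for Poisson processes and Bernoulli sums -/

section Poisson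

/-- The identity `E[N f(N)] = r E[f(N + 1)]` for Poisson `N`, by shifting the index. Taking `f = 1`
and `f(k) = k` yields the first two moments. -/
theorem hasSum_poisson_shift {r : ℝ≥0} {f : ℕ → ℝ} {c : ℝ}
    (h : HasSum (fun k : ℕ => Real.exp (-r) * r ^ k / (k.factorial : ℝ) * f (k + 1)) c) :
    HasSum (fun k : ℕ => Real.exp (-r) * r ^ k / (k.factorial : ℝ) * (k * f k)) (r * c) := by
  rw [← hasSum_nat_add_iff' 1]
  have e : (fun k : ℕ => Real.exp (-r) * (r : ℝ) ^ (k + 1) / ((k + 1).factorial : ℝ) *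
      (((k + 1 : ℕ) : ℝ) * f (k + 1))) =
      fun k : ℕ => (r : ℝ) * (Real.exp (-r) * r ^ k / (k.factorial : ℝ) * f (k + 1)) := by
    funext k
    rw [Nat.factorial_succ]
    push_cast
    field_simp
    ring
  rw [e]
  simpa using h.mul_left (r : ℝ)

/-- The variance of the Poisson distribution. -/
theorem hasSum_poisson_sq_sub (r : ℝ≥0) :
    HasSum (fun k : ℕ => Real.exp (-r) * r ^ k / (k.factorial : ℝ) * ((k : ℝ) - r) ^ 2) r := by
  have h0 := hasSum_one_poissonMeasure r
  have h1 := hasSum_poisson_shift (f := fun _ => 1) (r := r) (c := 1) (by simpa using h0)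
  have h2 := hasSum_poisson_shift (f := fun k => k) (r := r) (c := r * 1 + 1) (by
    convert h1.add h0 using 2
    push_cast
    ring)
  have h := (h2.sub (h1.mul_left (2 * (r : ℝ)))).add (h0.mul_left ((r : ℝ) ^ 2))
  have e : (r : ℝ) * (r * 1 + 1) - 2 * r * (r * 1) + r ^ 2 * 1 = r := by ring
  rw [e] at h
  refine h.congr_fun fun k => ?_
  ring

/-- Chebyshev's inequality, the variance being `r`. -/
theorem poissonMeasure_abs_sub_ge_le (r : ℝ≥0) {c : ℝ} (hc : 0 < c) :
    poissonMeasure r {k | c ≤ |(k : ℝ) - r|} ≤ ENNReal.ofReal (r / c ^ 2) := by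
  have hs := hasSum_poisson_sq_sub r
  have hint : Integrable (fun k : ℕ => ((k : ℝ) - r) ^ 2) (poissonMeasure r) := by
    rw [integrable_poissonMeasure_iff]
    simpa [abs_of_nonneg] using hs.summable
  have hval : ∫ k, ((k : ℝ) - r) ^ 2 ∂poissonMeasure r = r := by
    have h := hasSum_integral_poissonMeasure hint
    simp only [smul_eq_mul] at h
    exact h.unique hs
  have h := mul_meas_ge_le_integral_of_nonneg (Eventually.of_forall fun k => sq_nonneg _) hint
    (c ^ 2)
  rw [hval] at h
  have e : {k : ℕ | c ≤ |(k : ℝ) - r|} = {k : ℕ | c ^ 2 ≤ ((k : ℝ) - r) ^ 2} := by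
    ext k
    rw [mem_ofPred_eq, mem_ofPred_eq, sq_le_sq, abs_of_pos hc]
  rw [e, ← ofReal_measureReal]
  apply ENNReal.ofReal_le_ofReal
  rw [le_div_iff₀ (by positivity), mul_comm]
  exact h

end Poisson

section LawOfLargeNumbers

variable {Ω : ℕ+ → Type*} [∀ n, MeasurableSpace (Ω n)] {P : ∀ n, Measure (Ω n)}

theorem tendsto_ofReal_div_pnat (C : ℝ) :
    Tendsto (fun n : ℕ+ => ENNReal.ofReal (C / n)) atTop (𝓝 0) := by
  have h1 : Tendsto (fun n : ℕ+ => ((n : ℕ) : ℝ)) atTop atTop :=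
    tendsto_natCast_atTop_atTop.comp tendsto_PNat_val_atTop_atTop
  simpa using ENNReal.tendsto_ofReal (h1.const_div_atTop C)

theorem WithHighProbability.of_le_div {A : ∀ n, Ω n → Prop} (C : ℝ)
    (h : ∀ n : ℕ+, P n {ω | ¬ A n ω} ≤ ENNReal.ofReal (C / n)) :
    WithHighProbability P atTop A :=
  tendsto_of_tendsto_of_tendsto_of_le_of_le tendsto_const_nhds (tendsto_ofReal_div_pnat C)
    (fun _ => zero_le) h

/-- The weak law of large numbers for Poisson variables of mean `n y`. -/
theorem withHighProbability_poisson {Y : ∀ n, Ω n → ℕ} {y : ℝ≥0}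
    (hY : ∀ n : ℕ+, HasLaw (Y n) (poissonMeasure (n * y)) (P n)) {ε : ℝ} (hε : 0 < ε) :
    WithHighProbability P atTop fun n ω => |(Y n ω : ℝ) / n - y| < ε := by
  -- Variance `n y` against the squared deviation `(n ε) ^ 2`.
  refine .of_le_div (y / ε ^ 2) fun n => ?_
  have hn : (0 : ℝ) < n := by exact_mod_cast n.pos
  have h1 := poissonMeasure_abs_sub_ge_le (n * y) (mul_pos hn hε)
  rw [← (hY n).measure_eq (p := fun k => n * ε ≤ |(k : ℝ) - (n * y : ℝ≥0)|)
    (MeasurableSet.of_discrete)] at h1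
  refine (measure_mono ?_).trans (h1.trans (le_of_eq ?_))
  · intro ω hω
    rw [mem_ofPred_eq, not_lt] at hω
    rw [mem_ofPred_eq]
    have : (Y n ω : ℝ) - (n * y : ℝ≥0) = n * ((Y n ω : ℝ) / n - y) := by
      push_cast; field_simp
    rw [this, abs_mul, abs_of_pos hn]
    gcongr
  · congr 1
    push_cast
    field_simp

theorem IsPoissonProcess.hasLaw {Ω : Type*} [MeasurableSpace Ω] {r : ℝ≥0} {N : ℝ≥0 → Ω → ℕ}
    {P : Measure Ω} (h : IsPoissonProcess r N P) (t : ℝ≥0) :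
    HasLaw (N t) (poissonMeasure (r * t)) P := by
  have h1 := h.law_increments 0 t zero_le
  rw [tsub_zero] at h1
  refine h1.congr ?_
  filter_upwards [h.path] with ω hω
  rw [hω.1, tsub_zero]

/-- The functional law of large numbers for Poisson processes of rate `n r`. -/
theorem withHighProbability_poissonProcess {N : ∀ n, ℝ≥0 → Ω n → ℕ} {r : ℝ≥0}
    (hN : ∀ n : ℕ+, IsPoissonProcess (r * n) (N n) (P n)) (K : ℝ≥0) {ε : ℝ} (hε : 0 < ε) :
    WithHighProbability P atTop fun n ω => ∀ x ≤ K, |(N n x ω : ℝ) / n - r * x| < ε := by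
  refine WithHighProbability.forall_le_of_monotone (X := fun n x ω => (N n x ω : ℝ) / n)
    (fun n => ?_) (fun x ε hε => ?_) K hε
  · filter_upwards [(hN n).path] with ω hω x y hxy
    have : (N n x ω : ℝ) ≤ N n y ω := by exact_mod_cast hω.2.1 hxy
    dsimp only
    gcongr
  · have := withHighProbability_poisson (P := P) (Y := fun n => N n x) (y := r * x) (fun n => by
      have := (hN n).hasLaw x
      rwa [mul_comm r, mul_assoc] at this) hε
    simpa using this

/-- The functional law of large numbers for Poisson processes of rate `1`, accelerated by `n`. -/
theorem withHighProbability_unitPoissonProcess {N : ∀ n, ℝ≥0 → Ω n → ℕ}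
    (hN : ∀ n, IsPoissonProcess 1 (N n) (P n)) (K : ℝ≥0) {ε : ℝ} (hε : 0 < ε) :
    WithHighProbability P atTop fun n ω =>
      ∀ x ≤ K, |(N n (n * x) ω : ℝ) / n - x| < ε := by
  have h := WithHighProbability.forall_le_of_monotone (P := P) (l := atTop) (c := 1)
    (X := fun n x ω => (N n (n * x) ω : ℝ) / n)
    (fun n => ?_) (fun x ε hε => ?_) K hε
  · simpa using h
  · filter_upwards [(hN n).path] with ω hω x y hxy
    have h1 : (n : ℝ≥0) * x ≤ n * y := by gcongr
    have : (N n (n * x) ω : ℝ) ≤ N n (n * y) ω := by exact_mod_cast hω.2.1 h1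
    dsimp only
    gcongr
  · have := withHighProbability_poisson (P := P) (Y := fun n => N n (n * x)) (y := x) (fun n => by
      have := (hN n).hasLaw (n * x)
      rwa [one_mul] at this) hε
    simpa using this

theorem ae_le_one_of_hasLaw_bernoulli {Ω : Type*} [MeasurableSpace Ω] {P : Measure Ω} {Y : Ω → ℕ}
    {p : unitInterval} (hY : HasLaw Y (bernoulliMeasure 1 0 p) P) : ∀ᵐ ω ∂P, Y ω ≤ 1 := by
  rw [ae_iff, hY.measure_eq (p := fun k => ¬ k ≤ 1) MeasurableSet.of_discrete]
  rw [bernoulliMeasure_apply_of_notMem_of_notMem _ MeasurableSet.of_discrete (by simp) (by simp)]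

/-- Chebyshev's inequality for sums of independent Bernoulli variables. -/
theorem measure_abs_sum_bernoulli_sub_ge_le {Ω : Type*} [MeasurableSpace Ω] {P : Measure Ω}
    [IsProbabilityMeasure P] {B : ℕ → Ω → ℕ} {p : unitInterval}
    (hm : ∀ j, Measurable (B j)) (hlaw : ∀ j, HasLaw (B j) (bernoulliMeasure 1 0 p) P)
    (hind : iIndepFun B P) (k : ℕ) {c : ℝ} (hc : 0 < c) :
    P {ω | c ≤ |((∑ j ∈ Finset.range k, B j ω : ℕ) : ℝ) - p * k|} ≤ ENNReal.ofReal (k / c ^ 2) := by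
  let X : ℕ → Ω → ℝ := fun j ω => B j ω
  have hX1 : ∀ j, ∀ᵐ ω ∂P, ‖X j ω‖ ≤ 1 := fun j => by
    filter_upwards [ae_le_one_of_hasLaw_bernoulli (hlaw j)] with ω hω
    simpa [X] using hω
  have hXm : ∀ j, Measurable (X j) := fun j => measurable_from_nat.comp (hm j)
  have hL2 : ∀ j, MemLp (X j) 2 P := fun j => MemLp.of_bound (hXm j).aestronglyMeasurable 1 (hX1 j)
  have hE : ∀ j, ∫ ω, X j ω ∂P = p := fun j => by
    have := (hlaw j).integral_comp (f := fun k : ℕ => (k : ℝ)) (by fun_prop)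
    have e : ∫ ω, X j ω ∂P = ∫ k : ℕ, (k : ℝ) ∂(bernoulliMeasure 1 0 p) := this
    rw [e, integral_bernoulliMeasure]
    simp
  -- The crude bound `1` suffices: only a variance of order `k` is needed.
  have hV : ∀ j, variance (X j) P ≤ 1 := fun j => by
    refine (variance_le_expectation_sq (hXm j).aestronglyMeasurable).trans ?_
    calc P[X j ^ 2] ≤ ∫ _, (1 : ℝ) ∂P := by
          refine integral_mono_ae (hL2 j).integrable_sq (integrable_const _) ?_
          filter_upwards [hX1 j] with ω hω
          have := abs_le.1 hω
          simp only [Pi.pow_apply]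
          nlinarith [this.1, this.2]
      _ = 1 := by simp
  have hXind : iIndepFun X P := hind.comp (fun _ k => (k : ℝ)) fun _ => measurable_from_nat
  have hsum : variance (∑ j ∈ Finset.range k, X j) P ≤ k := by
    rw [IndepFun.variance_sum (fun j _ => hL2 j) fun i _ j _ hij => hXind.indepFun hij]
    calc ∑ j ∈ Finset.range k, variance (X j) P ≤ ∑ j ∈ Finset.range k, (1 : ℝ) :=
          Finset.sum_le_sum fun j _ => hV j
      _ = k := by simp
  have hES : P[∑ j ∈ Finset.range k, X j] = (p : ℝ) * k := by
    simp only [Finset.sum_apply]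
    rw [integral_finsetSum _ fun j _ => (hL2 j).integrable one_le_two]
    simp [hE, mul_comm]
  have h := meas_ge_le_variance_div_sq (memLp_finsetSum' (Finset.range k) fun j _ => hL2 j) hc
  rw [hES] at h
  refine le_trans (le_of_eq ?_) (h.trans (ENNReal.ofReal_le_ofReal (by gcongr)))
  congr 1
  ext ω
  simp [X]

/-- The functional law of large numbers for Bernoulli variables. -/
theorem withHighProbability_bernoulli [∀ n, IsProbabilityMeasure (P n)] {B : ∀ n, ℕ → Ω n → ℕ}
    {p : unitInterval} (hm : ∀ n j, Measurable (B n j))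
    (hlaw : ∀ n j, HasLaw (B n j) (bernoulliMeasure 1 0 p) (P n))
    (hind : ∀ n, iIndepFun (B n) (P n)) (K : ℝ≥0) {ε : ℝ} (hε : 0 < ε) :
    WithHighProbability P atTop fun n ω => ∀ k : ℕ, (k : ℝ) / n ≤ K →
      |((∑ j ∈ Finset.range k, B n j ω : ℕ) : ℝ) / n - p * (k / n)| < ε := by
  -- Extending the partial sums to real times `x` through `⌊n x⌋₊` gives monotone functions; the
  -- count `k` is recovered at `x = k / n`.
  have h := WithHighProbability.forall_le_of_monotone (P := P) (l := atTop)
    (c := unitInterval.toNNReal p)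
    (X := fun n x ω => ((∑ j ∈ Finset.range ⌊(n : ℝ≥0) * x⌋₊, B n j ω : ℕ) : ℝ) / n)
    (fun n => ?_) (fun x ε hε => ?_) K hε
  · refine h.mono (Eventually.of_forall fun n => Eventually.of_forall fun ω hω k hk => ?_)
    have hn : (n : ℝ≥0) ≠ 0 := by exact_mod_cast n.pos.ne'
    have := hω (k / n) (by rw [← NNReal.coe_le_coe]; push_cast; exact hk)
    rw [mul_div_cancel₀ _ hn, Nat.floor_natCast] at this
    simpa using this
  · refine Eventually.of_forall fun ω x y hxy => ?_
    have h1 : ⌊(n : ℝ≥0) * x⌋₊ ≤ ⌊(n : ℝ≥0) * y⌋₊ := Nat.floor_le_floor (by gcongr)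
    have : (∑ j ∈ Finset.range ⌊(n : ℝ≥0) * x⌋₊, B n j ω) ≤
        ∑ j ∈ Finset.range ⌊(n : ℝ≥0) * y⌋₊, B n j ω :=
      Finset.sum_le_sum_of_subset (Finset.range_subset_range.2 h1)
    dsimp only
    gcongr
  · have h1 : WithHighProbability P atTop fun n ω =>
        |((∑ j ∈ Finset.range ⌊(n : ℝ≥0) * x⌋₊, B n j ω : ℕ) : ℝ) - p * ⌊(n : ℝ≥0) * x⌋₊| <
          n * (ε / 2) := by
      refine .of_le_div (x / (ε / 2) ^ 2) fun n => ?_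
      have hn : (0 : ℝ) < n := by exact_mod_cast n.pos
      simp only [not_lt]
      refine (measure_abs_sum_bernoulli_sub_ge_le (hm n) (hlaw n) (hind n) _ (by positivity)).trans ?_
      apply ENNReal.ofReal_le_ofReal
      have h2 : (⌊(n : ℝ≥0) * x⌋₊ : ℝ) ≤ n * x := by
        exact_mod_cast Nat.floor_le (zero_le : 0 ≤ (n : ℝ≥0) * x)
      calc (⌊(n : ℝ≥0) * x⌋₊ : ℝ) / (n * (ε / 2)) ^ 2 ≤ (n * x) / (n * (ε / 2)) ^ 2 := by gcongr
        _ = _ := by field_simp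
    -- Replacing `n x` by its floor costs at most `1 / n` after scaling, which is then below `ε /
    -- 2`.
    have h2 : ∀ᶠ n : ℕ+ in atTop, 2 / ε < n := by
      have : Tendsto (fun n : ℕ+ => ((n : ℕ) : ℝ)) atTop atTop :=
        tendsto_natCast_atTop_atTop.comp tendsto_PNat_val_atTop_atTop
      exact this.eventually_gt_atTop _
    refine h1.mono ?_
    filter_upwards [h2] with n hn2
    refine Eventually.of_forall fun ω hω => ?_
    have hn : (0 : ℝ) < n := by exact_mod_cast n.pos
    have f1 : (⌊(n : ℝ≥0) * x⌋₊ : ℝ) ≤ n * x := by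
      exact_mod_cast Nat.floor_le (zero_le : 0 ≤ (n : ℝ≥0) * x)
    have f2 : (n * x : ℝ) < ⌊(n : ℝ≥0) * x⌋₊ + 1 := by
      exact_mod_cast Nat.lt_floor_add_one ((n : ℝ≥0) * x)
    have hp0 := p.2.1
    have hp1 := p.2.2
    set S := ((∑ j ∈ Finset.range ⌊(n : ℝ≥0) * x⌋₊, B n j ω : ℕ) : ℝ)
    set k := (⌊(n : ℝ≥0) * x⌋₊ : ℝ)
    change |S / n - (p : ℝ) * x| < ε
    have e : S / n - (p : ℝ) * x = (S - p * (n * x)) / n := by field_simp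
    rw [e, abs_div, abs_of_pos hn, div_lt_iff₀ hn]
    have h3 : 2 < n * ε := by rwa [div_lt_iff₀ hε] at hn2
    have h4 := abs_lt.1 hω
    have h5 : (p : ℝ) * (n * x) - p * k ≤ 1 := by nlinarith
    have h6 : (0 : ℝ) ≤ p * (n * x) - p * k := by nlinarith
    rw [abs_lt]
    constructor <;> linarith [h4.1, h4.2]

end LawOfLargeNumbers

/-! ### Pathwise analysis of the call center on good outcomes -/

theorem timeIntegral_nonneg {f : ℝ≥0 → ℝ} (hf : ∀ u, 0 ≤ f u) (t : ℝ≥0) : 0 ≤ timeIntegral f t :=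
  intervalIntegral.integral_nonneg t.2 fun _ _ => hf _

theorem timeIntegral_le_mul {f : ℝ≥0 → ℝ} {C : ℝ} {t : ℝ≥0} (hf : ∀ u ≤ t, |f u| ≤ C) :
    timeIntegral f t ≤ C * t := by
  have h := intervalIntegral.norm_integral_le_of_norm_le_const (a := (0 : ℝ)) (b := t) (C := C)
    (f := fun u : ℝ => f u.toNNReal) fun u hu => by
      rw [uIoc_of_le t.coe_nonneg] at hu
      exact hf _ (Real.toNNReal_le_iff_le_coe.2 hu.2)
  rw [sub_zero, NNReal.abs_eq] at h
  exact (le_abs_self _).trans h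

theorem timeIntegral_const_mul (c : ℝ) (f : ℝ≥0 → ℝ) (t : ℝ≥0) :
    timeIntegral (fun u => c * f u) t = c * timeIntegral f t :=
  intervalIntegral.integral_const_mul _ _

namespace CallCenterModel

variable {prm : CallCenterParams} {n : ℕ+} {Ω : Type*} [MeasurableSpace Ω] {P : Measure Ω}
  (M : CallCenterModel prm n P)

theorem scaled_apply (ω : Ω) (t : ℝ≥0) (i : Fin 3) : M.scaled ω t i = (M.Z ω t i : ℝ) / n := rfl

theorem Z_eq_mul_scaled (ω : Ω) (t : ℝ≥0) (i : Fin 3) : (M.Z ω t i : ℝ) = n * M.scaled ω t i := by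
  have hn : (n : ℝ) ≠ 0 := by exact_mod_cast n.pos.ne'
  rw [scaled_apply]; field_simp

theorem scaled_nonneg (ω : Ω) (t : ℝ≥0) (i : Fin 3) : 0 ≤ M.scaled ω t i := by
  rw [scaled_apply]; positivity

theorem measurable_scaled : Measurable M.scaled := by
  refine SkorokhodSpace.measurable_of_eval fun t => measurable_pi_lambda _ fun i => ?_
  have h : Measurable fun x : Fin 3 → ℕ => (x i : ℝ) / n := by fun_prop
  exact h.comp (M.measurable_Z t)

theorem iIndepFun_redialDecision : iIndepFun M.redialDecision P :=
  M.indep.precomp (g := Source.redialDecision) fun _ _ h => by injection h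

theorem iIndepFun_reconnectDecision : iIndepFun M.reconnectDecision P :=
  M.indep.precomp (g := Source.reconnectDecision) fun _ _ h => by injection h

/-- A bound for the scaled number of customers in the system up to time `T`. -/
noncomputable def stateBound (prm : CallCenterParams) (z₀ : Fin 3 → ℝ) (T : ℝ≥0) : ℝ :=
  |z₀ 0| + |z₀ 1| + |z₀ 2| + prm.lam * T + 4

theorem stateBound_nonneg (prm : CallCenterParams) (z₀ : Fin 3 → ℝ) (T : ℝ≥0) :
    0 ≤ stateBound prm z₀ T := by
  unfold stateBound; positivity

/-- A bound for the scaled cumulative intensities up to time `T`. -/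
noncomputable def intensityBound (prm : CallCenterParams) (z₀ : Fin 3 → ℝ) (T : ℝ≥0) : ℝ≥0 :=
  (driftLipschitz prm * (stateBound prm z₀ T * T)).toNNReal

theorem coe_intensityBound (prm : CallCenterParams) (z₀ : Fin 3 → ℝ) (T : ℝ≥0) :
    (intensityBound prm z₀ T : ℝ) = driftLipschitz prm * (stateBound prm z₀ T * T) :=
  Real.coe_toNNReal _ (mul_nonneg (by positivity)
    (mul_nonneg (stateBound_nonneg prm z₀ T) (by positivity)))

/-- The outcomes whose primitive data are, up to time `T`, within `ε` of their fluid limits. -/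
structure GoodPath (z₀ : Fin 3 → ℝ) (T : ℝ≥0) (ε : ℝ) (ω : Ω) : Prop where
  initial : ∀ i, |M.scaled ω 0 i - z₀ i| < ε
  fresh : ∀ x ≤ T, |(M.clock .fresh x ω : ℝ) / n - prm.lam * x| < ε
  unit : ∀ c, c ≠ .fresh → ∀ x ≤ intensityBound prm z₀ T, |(M.clock c (n * x) ω : ℝ) / n - x| < ε
  redial : ∀ k : ℕ, (k : ℝ) / n ≤ (intensityBound prm z₀ T + 1 : ℝ≥0) →
    |((∑ j ∈ Finset.range k, M.redialDecision j ω : ℕ) : ℝ) / n - prm.p * (k / n)| < ε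
  reconnect : ∀ k : ℕ, (k : ℝ) / n ≤ (intensityBound prm z₀ T + 1 : ℝ≥0) →
    |((∑ j ∈ Finset.range k, M.reconnectDecision j ω : ℕ) : ℝ) / n - prm.q * (k / n)| < ε
  redial_le_one : ∀ j, M.redialDecision j ω ≤ 1
  reconnect_le_one : ∀ j, M.reconnectDecision j ω ≤ 1
  flow_Q : ∀ t, (M.Z ω t 0 : ℤ) = M.Z ω 0 0 + M.clock .fresh t ω + M.DRD t ω + M.DRC t ω
    - M.Ds t ω - M.Da t ω
  flow_RD : ∀ t, (M.Z ω t 1 : ℤ) = M.Z ω 0 1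
    + (∑ j ∈ Finset.range (M.Da t ω), M.redialDecision j ω : ℕ) - M.DRD t ω
  flow_RC : ∀ t, (M.Z ω t 2 : ℤ) = M.Z ω 0 2
    + (∑ j ∈ Finset.range (M.Ds t ω), M.reconnectDecision j ω : ℕ) - M.DRC t ω

variable {M} {z₀ : Fin 3 → ℝ} {T : ℝ≥0} {ε : ℝ} {ω : Ω}

/-- The number of customers in the system is at most the initial number plus the number of fresh
arrivals. -/
theorem GoodPath.sum_le (h : M.GoodPath z₀ T ε ω) (t : ℝ≥0) :
    M.Z ω t 0 + M.Z ω t 1 + M.Z ω t 2 ≤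
      M.Z ω 0 0 + M.Z ω 0 1 + M.Z ω 0 2 + M.clock .fresh t ω := by
  have h1 : ∑ j ∈ Finset.range (M.Da t ω), M.redialDecision j ω ≤ M.Da t ω := by
    simpa using Finset.sum_le_card_nsmul (Finset.range (M.Da t ω)) _ 1
      fun j _ => h.redial_le_one j
  have h2 : ∑ j ∈ Finset.range (M.Ds t ω), M.reconnectDecision j ω ≤ M.Ds t ω := by
    simpa using Finset.sum_le_card_nsmul (Finset.range (M.Ds t ω)) _ 1
      fun j _ => h.reconnect_le_one j
  have e0 := h.flow_Q t
  have e1 := h.flow_RD t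
  have e2 := h.flow_RC t
  -- In the sum of the three flow equations redials and reconnects cancel, and each departure sends
  -- at most one customer to an orbit.
  omega

theorem GoodPath.scaled_le (h : M.GoodPath z₀ T ε ω) (hε : ε ≤ 1) {t : ℝ≥0} (ht : t ≤ T)
    (i : Fin 3) : M.scaled ω t i ≤ stateBound prm z₀ T := by
  have hn : (0 : ℝ) < n := by exact_mod_cast n.pos
  have h1 : (M.Z ω t 0 : ℝ) + M.Z ω t 1 + M.Z ω t 2 ≤
      M.Z ω 0 0 + M.Z ω 0 1 + M.Z ω 0 2 + M.clock .fresh t ω := by exact_mod_cast h.sum_le t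
  have h2 : M.scaled ω t 0 + M.scaled ω t 1 + M.scaled ω t 2 ≤
      M.scaled ω 0 0 + M.scaled ω 0 1 + M.scaled ω 0 2 + M.clock .fresh t ω / n := by
    simp only [scaled_apply, ← add_div]
    gcongr
  have hz : ∀ i, M.scaled ω 0 i ≤ |z₀ i| + 1 := fun i => by
    have a1 := (abs_lt.1 (h.initial i)).2
    have a2 := le_abs_self (z₀ i)
    linarith
  have hf := (abs_lt.1 (h.fresh t ht)).2
  have hlt : (prm.lam : ℝ) * t ≤ prm.lam * T := by gcongr
  have n0 := M.scaled_nonneg ω t 0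
  have n1 := M.scaled_nonneg ω t 1
  have n2 := M.scaled_nonneg ω t 2
  have z0 := hz 0
  have z1 := hz 1
  have z2 := hz 2
  -- The `4` in the bound covers three initial errors and one arrival error, each at most `ε ≤ 1`.
  unfold stateBound
  fin_cases i <;> simp only [Fin.zero_eta, Fin.mk_one, Fin.reduceFinMk] <;> linarith

theorem GoodPath.intervalIntegrable (h : M.GoodPath z₀ T ε ω) (hε : ε ≤ 1) {t : ℝ≥0} (ht : t ≤ T)
    (i : Fin 3) : IntervalIntegrable (fun u : ℝ => M.scaled ω u.toNNReal i) volume 0 t := by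
  rw [intervalIntegrable_iff_integrableOn_Ioc_of_le t.coe_nonneg]
  refine Measure.integrableOn_of_bounded (M := stateBound prm z₀ T) (by simp) ?_ ?_
  · exact ((measurable_pi_apply i).comp ((M.scaled ω).measurable_toFun.comp
      measurable_real_toNNReal)).aestronglyMeasurable
  · refine (ae_restrict_iff' measurableSet_Ioc).2 (Eventually.of_forall fun u hu => ?_)
    rw [Real.norm_of_nonneg (M.scaled_nonneg _ _ _)]
    exact h.scaled_le hε ((Real.toNNReal_le_iff_le_coe.2 hu.2).trans ht) i

/-- Along a good path, a counting process is close to its intensity. -/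
theorem GoodPath.abs_clock_sub_lt (h : M.GoodPath z₀ T ε ω) {c : Clock} (hc : c ≠ .fresh)
    {r : ℝ≥0} (hr : r ≤ driftLipschitz prm) {g f : ℝ≥0 → ℝ} (hg : ∀ u, g u = n * (r * f u))
    (hf : ∀ u, 0 ≤ f u) (hfb : ∀ u ≤ T, f u ≤ stateBound prm z₀ T) {t : ℝ≥0} (ht : t ≤ T) :
    |(M.clock c (timeIntegral g t).toNNReal ω : ℝ) / n - r * timeIntegral f t| < ε ∧
      r * timeIntegral f t ≤ intensityBound prm z₀ T := by
  have h0 : 0 ≤ timeIntegral f t := timeIntegral_nonneg hf t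
  have h1 : timeIntegral f t ≤ stateBound prm z₀ T * T :=
    (timeIntegral_le_mul fun u hu => by
      rw [abs_of_nonneg (hf u)]; exact hfb u (hu.trans ht)).trans
      (mul_le_mul_of_nonneg_left ht (stateBound_nonneg _ _ _))
  have h2 : r * timeIntegral f t ≤ intensityBound prm z₀ T := by
    rw [coe_intensityBound]
    have : (r : ℝ) ≤ driftLipschitz prm := by exact_mod_cast hr
    gcongr
  have h3 : (timeIntegral g t).toNNReal = n * (r * timeIntegral f t).toNNReal := by
    rw [funext hg, timeIntegral_const_mul, timeIntegral_const_mul,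
      Real.toNNReal_mul (by positivity), Real.toNNReal_natCast]
  -- By `h2` the random time lies in the window where the clock is uniformly controlled.
  have h4 := h.unit c hc (r * timeIntegral f t).toNNReal (Real.toNNReal_le_iff_le_coe.2 h2)
  rw [Real.coe_toNNReal _ (by positivity)] at h4
  rw [h3]
  exact ⟨h4, h2⟩

/-- Along a good path, the scaled process nearly solves the fluid equations. -/
theorem GoodPath.abs_scaled_sub_le (h : M.GoodPath z₀ T ε ω) (hε : ε ≤ 1) {t : ℝ≥0} (ht : t ≤ T)
    (i : Fin 3) :
    |M.scaled ω t i - z₀ i - timeIntegral (fun u => drift prm (M.scaled ω u) i) t| ≤ 6 * ε := by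
  have hn : (0 : ℝ) < n := by exact_mod_cast n.pos
  have hε0 : 0 < ε := (abs_nonneg _).trans_lt (h.initial 0)
  have hint := fun i => h.intervalIntegrable hε ht i
  have hb := stateBound_nonneg prm z₀ T
  obtain ⟨hs, hs'⟩ := h.abs_clock_sub_lt (c := .service) (by simp) (r := prm.mu)
    (by unfold driftLipschitz; exact (le_add_self).trans le_self_add)
    (g := fun u => prm.mu * min ((n : ℝ) * prm.s) (M.Z ω u 0))
    (f := fun u => min (prm.s : ℝ) (M.scaled ω u 0))
    (fun u => by rw [Z_eq_mul_scaled, ← mul_min_of_nonneg _ _ hn.le]; ring)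
    (fun u => le_min (by positivity) (M.scaled_nonneg _ _ _))
    (fun u hu => (min_le_right _ _).trans (h.scaled_le hε hu 0)) ht
  obtain ⟨ha, ha'⟩ := h.abs_clock_sub_lt (c := .abandonment) (by simp) (r := prm.theta)
    (by unfold driftLipschitz; exact le_add_self)
    (g := fun u => prm.theta * max ((M.Z ω u 0 : ℝ) - n * prm.s) 0)
    (f := fun u => max (M.scaled ω u 0 - prm.s) 0)
    (fun u => by
      have := mul_max_of_nonneg (M.scaled ω u 0 - prm.s) 0 hn.le
      rw [mul_zero] at this
      rw [Z_eq_mul_scaled, ← mul_sub, ← this]; ring)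
    (fun u => le_max_right _ _)
    (fun u hu => max_le ((sub_le_self _ (by positivity)).trans (h.scaled_le hε hu 0)) hb) ht
  obtain ⟨hrd, -⟩ := h.abs_clock_sub_lt (c := .redial) (by simp) (r := prm.deltaRD)
    (by unfold driftLipschitz; rw [add_assoc, add_assoc]; exact le_self_add)
    (g := fun u => prm.deltaRD * (M.Z ω u 1 : ℝ)) (f := fun u => M.scaled ω u 1)
    (fun u => by rw [Z_eq_mul_scaled]; ring) (fun u => M.scaled_nonneg _ _ _)
    (fun u hu => h.scaled_le hε hu 1) ht
  obtain ⟨hrc, -⟩ := h.abs_clock_sub_lt (c := .reconnect) (by simp) (r := prm.deltaRC)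
    (by unfold driftLipschitz; rw [add_assoc]; exact le_add_self.trans le_self_add)
    (g := fun u => prm.deltaRC * (M.Z ω u 2 : ℝ)) (f := fun u => M.scaled ω u 2)
    (fun u => by rw [Z_eq_mul_scaled]; ring) (fun u => M.scaled_nonneg _ _ _)
    (fun u hu => h.scaled_le hε hu 2) ht
  rw [← M.Ds_eq] at hs
  rw [← M.Da_eq] at ha
  rw [← M.DRD_eq] at hrd
  rw [← M.DRC_eq] at hrc
  have hf := abs_lt.1 (h.fresh t ht)
  -- The scaled count exceeds its intensity by less than `ε ≤ 1`, which is why `GoodPath` controls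
  -- decisions up to `intensityBound + 1`.
  have hB := abs_lt.1 (h.redial (M.Da t ω) (by
    push_cast; linarith [(abs_lt.1 ha).2]))
  have hB' := abs_lt.1 (h.reconnect (M.Ds t ω) (by
    push_cast; linarith [(abs_lt.1 hs).2]))
  have e0 : M.scaled ω t 0 = M.scaled ω 0 0 + M.clock .fresh t ω / n + M.DRD t ω / n
      + M.DRC t ω / n - M.Ds t ω / n - M.Da t ω / n := by
    have : (M.Z ω t 0 : ℝ) = M.Z ω 0 0 + M.clock .fresh t ω + M.DRD t ω + M.DRC t ω
      - M.Ds t ω - M.Da t ω := by exact_mod_cast h.flow_Q t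
    rw [scaled_apply, scaled_apply, this]
    ring
  have e1 : M.scaled ω t 1 = M.scaled ω 0 1
      + ((∑ j ∈ Finset.range (M.Da t ω), M.redialDecision j ω : ℕ) : ℝ) / n - M.DRD t ω / n := by
    have : (M.Z ω t 1 : ℝ) = M.Z ω 0 1
        + ((∑ j ∈ Finset.range (M.Da t ω), M.redialDecision j ω : ℕ) : ℝ) - M.DRD t ω := by
      exact_mod_cast h.flow_RD t
    rw [scaled_apply, scaled_apply, this]
    ring
  have e2 : M.scaled ω t 2 = M.scaled ω 0 2
      + ((∑ j ∈ Finset.range (M.Ds t ω), M.reconnectDecision j ω : ℕ) : ℝ) / n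
      - M.DRC t ω / n := by
    have : (M.Z ω t 2 : ℝ) = M.Z ω 0 2
        + ((∑ j ∈ Finset.range (M.Ds t ω), M.reconnectDecision j ω : ℕ) : ℝ) - M.DRC t ω := by
      exact_mod_cast h.flow_RC t
    rw [scaled_apply, scaled_apply, this]
    ring
  -- A thinned stream has two errors: that of the Bernoulli average, and `p` or `q` times that of
  -- the departure clock.
  have hthin : ∀ (r : unitInterval) (a : ℝ), |a| < ε → |(r : ℝ) * a| < ε := fun r a ha => by
    rw [abs_mul, abs_of_nonneg r.2.1]
    exact (mul_le_of_le_one_left (abs_nonneg _) r.2.2).trans_lt ha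
  have hpa := abs_lt.1 (hthin prm.p _ ha)
  have hqs := abs_lt.1 (hthin prm.q _ hs)
  have i0 := abs_lt.1 (h.initial 0)
  have i1 := abs_lt.1 (h.initial 1)
  have i2 := abs_lt.1 (h.initial 2)
  rw [abs_lt] at hs ha hrd hrc
  rw [abs_le]
  -- Coordinate `Q` collects six errors (initial, arrivals, four clocks); each orbit collects four.
  fin_cases i <;> simp only [Fin.zero_eta, Fin.mk_one, Fin.reduceFinMk]
  · rw [timeIntegral_drift_zero hint, e0]
    constructor <;> linarith
  · rw [timeIntegral_drift_one hint, e1]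
    constructor <;> linarith
  · rw [timeIntegral_drift_two hint, e2]
    constructor <;> linarith

theorem GoodPath.dist_scaled_le (h : M.GoodPath z₀ T ε ω) (hε : ε ≤ 1) {z : ℝ≥0 → Fin 3 → ℝ}
    (hz : IsFluidSolution prm z₀ z) {t : ℝ≥0} (ht : t ≤ T) :
    dist (M.scaled ω t) (z t) ≤ 6 * ε * Real.exp (driftLipschitz prm * T) := by
  have hε0 : 0 < ε := (abs_nonneg _).trans_lt (h.initial 0)
  obtain ⟨hzi, hz⟩ := isFluidSolution_iff.1 hz
  refine (dist_le_of_approx_fluid prm (a := 6 * ε) (by positivity)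
    (fun i => h.intervalIntegrable hε le_rfl i) (fun i => hzi i T) (fun t ht i => ?_) t ht).trans ?_
  · rw [hz t i]
    convert h.abs_scaled_sub_le hε ht i using 2
    ring
  · gcongr

end CallCenterModel

/-! ### Good outcomes are likely, and the fluid limit follows -/

theorem withHighProbability_goodPath {prm : CallCenterParams} {Ω : ℕ+ → Type*}
    [∀ n, MeasurableSpace (Ω n)] {P : (n : ℕ+) → Measure (Ω n)} [∀ n, IsProbabilityMeasure (P n)]
    (M : (n : ℕ+) → CallCenterModel prm n (P n)) {z₀ : Fin 3 → ℝ}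
    (h₀ : TendstoInDistribution (fun n ω => (M n).scaled ω 0) atTop (fun _ : Unit => z₀)
      P (Measure.dirac ())) (T : ℝ≥0) {ε : ℝ} (hε : 0 < ε) :
    WithHighProbability P atTop fun n ω => (M n).GoodPath z₀ T ε ω := by
  have h1 := h₀.withHighProbability Metric.isOpen_ball (Metric.mem_ball_self hε)
  have h2 := withHighProbability_poissonProcess (P := P) (fun n => (M n).poisson_fresh) T hε
  have h3 := fun c (hc : c ≠ .fresh) => withHighProbability_unitPoissonProcess (P := P)
    (fun n => (M n).poisson_unit c hc) (CallCenterModel.intensityBound prm z₀ T) hε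
  have h4 := withHighProbability_bernoulli (P := P) (fun n => (M n).measurable_redialDecision)
    (fun n => (M n).law_redialDecision) (fun n => (M n).iIndepFun_redialDecision)
    (CallCenterModel.intensityBound prm z₀ T + 1) hε
  have h5 := withHighProbability_bernoulli (P := P) (fun n => (M n).measurable_reconnectDecision)
    (fun n => (M n).law_reconnectDecision) (fun n => (M n).iIndepFun_reconnectDecision)
    (CallCenterModel.intensityBound prm z₀ T + 1) hε
  refine (h1.and (h2.and (((h3 .service (by simp)).and (h3 .abandonment (by simp))).and
    (((h3 .redial (by simp)).and (h3 .reconnect (by simp))).and (h4.and h5))))).mono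
    (Eventually.of_forall fun n => ?_)
  filter_upwards [ae_all_iff.2 fun j => ae_le_one_of_hasLaw_bernoulli ((M n).law_redialDecision j),
    ae_all_iff.2 fun j => ae_le_one_of_hasLaw_bernoulli ((M n).law_reconnectDecision j),
    (M n).flow_Q, (M n).flow_RD, (M n).flow_RC] with ω b1 b2 fQ fRD fRC
  rintro ⟨i, f, ⟨us, ua⟩, ⟨ud, uc⟩, rd, rc⟩
  refine ⟨fun j => (dist_le_pi_dist _ _ j).trans_lt i, f, ?_, rd, rc, b1, b2, fQ, fRD, fRC⟩
  rintro (_ | _ | _ | _ | _) hc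
  exacts [absurd rfl hc, us, ua, ud, uc]

theorem theorem1 (prm : CallCenterParams) {Ω : ℕ+ → Type*} [∀ n, MeasurableSpace (Ω n)]
    (P : (n : ℕ+) → Measure (Ω n)) [∀ n, IsProbabilityMeasure (P n)]
    (M : (n : ℕ+) → CallCenterModel prm n (P n)) (z₀ : Fin 3 → ℝ)
    (h₀ : TendstoInDistribution (fun n ω => (M n).scaled ω 0) atTop (fun _ : Unit => z₀)
      P (Measure.dirac ())) :
    ∃ z : SkorokhodSpace (Fin 3 → ℝ),
      Continuous z.toFun ∧
      IsFluidSolution prm z₀ z.toFun ∧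
      (∀ w : ℝ≥0 → Fin 3 → ℝ, IsFluidSolution prm z₀ w → w = z.toFun) ∧
      TendstoInDistribution (fun n ω => (M n).scaled ω) atTop (fun _ : Unit => z)
        P (Measure.dirac ()) := by
  obtain ⟨z, hzc, hz⟩ := exists_isFluidSolution prm z₀
  refine ⟨⟨z, fun t => hzc.continuousWithinAt, fun t => ⟨z t, hzc.continuousWithinAt⟩⟩, hzc, hz,
    fun w hw => hz.unique hw, tendstoInDistribution_of_withHighProbability
      (fun n => (M n).measurable_scaled.aemeasurable) fun U hU => ?_⟩
  obtain ⟨⟨T, ε⟩, hε, hsub⟩ := (SkorokhodSpace.hasBasis_nhds _).mem_iff.1 hU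
  -- The primitive error `η` is chosen so that its Grönwall amplification on `[0, T]` stays below
  -- `ε`.
  obtain ⟨η, hη, hη1, hηε⟩ : ∃ η : ℝ, 0 < η ∧ η ≤ 1 ∧
      6 * η * Real.exp (driftLipschitz prm * T) < ε := by
    have hC : 0 < 6 * Real.exp (driftLipschitz prm * T) := by positivity
    refine ⟨min 1 (ε / (2 * (6 * Real.exp (driftLipschitz prm * T)))),
      lt_min one_pos (div_pos hε (by positivity)), min_le_left _ _, ?_⟩
    calc 6 * min 1 (ε / (2 * (6 * Real.exp (driftLipschitz prm * T))))
          * Real.exp (driftLipschitz prm * T)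
        ≤ 6 * (ε / (2 * (6 * Real.exp (driftLipschitz prm * T))))
          * Real.exp (driftLipschitz prm * T) := by gcongr; exact min_le_right _ _
      _ = ε / 2 := by field_simp
      _ < ε := half_lt_self hε
  refine (withHighProbability_goodPath M h₀ T hη).mono
    (Eventually.of_forall fun n => Eventually.of_forall fun ω h => hsub ?_)
  -- Closeness is uniform on `[0, T]`, so the identity serves as time change.
  refine ⟨OrderIso.refl _, fun t ht => ⟨by simpa using hε, ?_⟩⟩
  rw [dist_comm]
  exact (h.dist_scaled_le hη1 hz ht).trans_lt hηε
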